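/- Let $R$ be an integral domain (for example an arbitrary field, or $\mathbb Z$) and let $n\ge 0$. Let $H_n(0)$ be the $0$-Hecke algebra over $R$: the associative unital $R$-algebra generated by $T_1,\dots,T_{n-1}$ with relations $T_i^2=-T_i$, $T_iT_{i+1}T_i=T_{i+1}T_iT_{i+1}$, and $T_iT_j=T_jT_i$ for $|i-j|>1$. Put $T'_i=T_i+1$. For $w\in\mathfrak S_n$ with reduced expression $w=s_{i_1}\cdots s_{i_k}$, where $s_i=(i,i+1)$, put $T_w=T_{i_1}\cdots T_{i_k}$ and $T'_w=T'_{i_1}\cdots T'_{i_k}$; these do not depend on the reduced expression. Let $H_n(0)$ act on the coinvariant algebra $C_n=R[x_1,\dots,x_n]/(R[\mathbf x]^{\mathfrak S_n}_+)$, the quotient by the ideal generated by the symmetric polynomials without constant term, by $T_i\mapsto\overline\pi_i:=\pi_i-1$, where $$\pi_i f=\frac{x_if-x_{i+1}s_i(f)}{x_i-x_{i+1}}$$ and $s_i$ exchanges the variables $x_i$ and $x_{i+1}$. Put $\overline\pi_w=\overline\pi_{i_1}\cdots\overline\pi_{i_k}$ for a reduced expression of $w$ as above. For $w\in\mathfrak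 S_n$ let $D(w)=\{i\in[n-1]: w(i)>w(i+1)\}$. For a composition $\alpha=(\alpha_1,\dots,\alpha_\ell)$ of $n$ let $D(\alpha)=\{\alpha_1,\ \alpha_1+\alpha_2,\ \dots,\ \alpha_1+\cdots+\alpha_{\ell-1}\}\subseteq[n-1]$, let $\alpha^c$ be the composition of $n$ with $D(\alpha^c)=[n-1]\setminus D(\alpha)$, and let $w_0(\alpha)$ be the longest element of the subgroup of $\mathfrak S_n$ generated by $\{s_i:i\in D(\alpha)\}$. For $I\subseteq[n-1]$ let $x_I=\prod_{i\in I}x_1\cdots x_i$. Polynomials are identified with their images in $C_n$. Finally let $\mathbf P_\alpha=H_n(0)\cdot T_{w_0(\alpha)}T'_{w_0(\alpha^c)}$ be Norton's left ideal. Then: 1. The Demazure atoms $\{\overline\pi_w x_{D(w)}: w\in\mathfrak S_n\}$ form an $R$-basis of $C_n$. 2. There is a direct sum decomposition of $H_n(0)$-modules $$C_n=\bigoplus_{\alpha\models n}H_n(0)\cdot\overline\pi_{w_0(\alpha)}x_{D(\alpha)} .$$ 3. For every composition $\alpha$ of $n$, the summand $H_n(0)\cdot\overline\pi_{w_0(\alpha)}x_{D(\alpha)}$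 has the $R$-basis $\{\overline\pi_w x_{D(\alpha)}: w\in\mathfrak S_n,\ D(w)=D(\alpha)\}$ and is isomorphic, as an $H_n(0)$-module, to $\mathbf P_\alpha$, which is a projective and indecomposable $H_n(0)$-module. 4. Consequently $C_n$ is isomorphic, as an $H_n(0)$-module, to the regular representation of $H_n(0)$, i.e. to $H_n(0)$ as a left module over itself. -/

import Mathlib

open Equiv (Perm)

noncomputable section

namespace Coinv

/-! ### Permutations

The symmetric group `𝔖_n` is `Perm (Fin n)`; the element `i : Fin n` stands for the number `i + 1`
of `{1, …, n}`, and `i : Fin (n - 1)` stands for the number `i + 1` of `[n - 1] = {1, …, n - 1}`.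
Products of permutations are compositions of functions. -/

/-- The element `i` of `[n - 1]`, regarded as an element of `{1, …, n}`. -/
def lo {n : ℕ} (i : Fin (n - 1)) : Fin n := ⟨i, by omega⟩

/-- The successor of the element `i` of `[n - 1]`, as an element of `{1, …, n}`. -/
def hi {n : ℕ} (i : Fin (n - 1)) : Fin n := ⟨i + 1, by omega⟩

theorem lo_ne_hi {n : ℕ} (i : Fin (n - 1)) : lo i ≠ hi i := by
  simp [lo, hi]

/-- The adjacent transposition `s_i = (i, i+1)`. -/
def s {n : ℕ} (i : Fin (n - 1)) : Perm (Fin n) := Equiv.swap (lo i) (hi i)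

/-- The word `l = (i_1, …, i_k)` is a reduced expression of `w`: `w = s_{i_1} ⋯ s_{i_k}`, and no
shorter word has this product. -/
def IsReducedWord {n : ℕ} (w : Perm (Fin n)) (l : List (Fin (n - 1))) : Prop :=
  (l.map s).prod = w ∧ ∀ l' : List (Fin (n - 1)), (l'.map s).prod = w → l.length ≤ l'.length

theorem exists_word {n : ℕ} (w : Perm (Fin n)) :
    ∃ l : List (Fin (n - 1)), (l.map s).prod = w := by
  cases n with
  | zero => exact ⟨[], Subsingleton.elim _ _⟩
  | succ m =>
    have hw : w ∈ Submonoid.closure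
        (Set.range fun i : Fin m => Equiv.swap i.castSucc i.succ) := by
      rw [Equiv.Perm.mclosure_swap_castSucc_succ]; trivial
    induction hw using Submonoid.closure_induction with
    | mem x hx =>
      obtain ⟨i, rfl⟩ := hx
      exact ⟨[i], by simp [s]; rfl⟩
    | one => exact ⟨[], rfl⟩
    | mul x y _ _ hx hy =>
      obtain ⟨a, rfl⟩ := hx
      obtain ⟨b, rfl⟩ := hy
      exact ⟨a ++ b, by simp⟩

theorem exists_isReducedWord {n : ℕ} (w : Perm (Fin n)) :
    ∃ l : List (Fin (n - 1)), IsReducedWord w l := by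
  classical
  have h : ∃ k, ∃ l : List (Fin (n - 1)), (l.map s).prod = w ∧ l.length = k := by
    obtain ⟨l, hl⟩ := exists_word w
    exact ⟨_, l, hl, rfl⟩
  obtain ⟨l, hl, hk⟩ := Nat.find_spec h
  exact ⟨l, hl, fun l' hl' => hk ▸ Nat.find_min' h ⟨l', hl', rfl⟩⟩

/-- A reduced expression of `w`. -/
def reducedWord {n : ℕ} (w : Perm (Fin n)) : List (Fin (n - 1)) :=
  Classical.choose (exists_isReducedWord w)

theorem isReducedWord_reducedWord {n : ℕ} (w : Perm (Fin n)) : IsReducedWord w (reducedWord w) :=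
  Classical.choose_spec (exists_isReducedWord w)

/-- The length `ℓ(w)` of a permutation. -/
def len {n : ℕ} (w : Perm (Fin n)) : ℕ := (reducedWord w).length

/-- The descent set `D(w) = {i ∈ [n - 1] : w(i) > w(i+1)}`. -/
def descentSet {n : ℕ} (w : Perm (Fin n)) : Finset (Fin (n - 1)) :=
  Finset.univ.filter fun i => w (hi i) < w (lo i)

/-- The parabolic subgroup of `𝔖_n` generated by the `s_i` with `i ∈ I`. -/
def parabolic {n : ℕ} (I : Finset (Fin (n - 1))) : Subgroup (Perm (Fin n)) :=
  Subgroup.closure (s '' (I : Set (Fin (n - 1))))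

theorem exists_longest {n : ℕ} (I : Finset (Fin (n - 1))) :
    ∃ w ∈ parabolic I, ∀ u ∈ parabolic I, len u ≤ len w :=
  Set.exists_max_image (parabolic I : Set (Perm (Fin n))) len (Set.toFinite _)
    ⟨1, (parabolic I).one_mem⟩

/-- The longest element of the parabolic subgroup attached to `I`. -/
def w₀ {n : ℕ} (I : Finset (Fin (n - 1))) : Perm (Fin n) :=
  Classical.choose (exists_longest I)

/-- The descent set `D(α) = {σ_1, …, σ_{ℓ-1}} ⊆ [n - 1]` of a composition `α = (α_1, …, α_ℓ)` of
`n`, where `σ_j = α_1 + ⋯ + α_j`. -/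
def compDescentSet {n : ℕ} (α : Composition n) : Finset (Fin (n - 1)) :=
  Finset.univ.filter fun i => (i : ℕ) + 1 ∈ (Finset.Ioo 0 α.length).image α.sizeUpTo

/-! ### The `0`-Hecke algebra -/

/-- The defining relations of the `0`-Hecke algebra. -/
inductive HeckeRel (R : Type*) [CommRing R] (n : ℕ) :
    FreeAlgebra R (Fin (n - 1)) → FreeAlgebra R (Fin (n - 1)) → Prop
  | quad (i : Fin (n - 1)) :
      HeckeRel R n (FreeAlgebra.ι R i * FreeAlgebra.ι R i) (-FreeAlgebra.ι R i)
  | braid (i j : Fin (n - 1)) (h : (i : ℕ) + 1 = j) :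
      HeckeRel R n (FreeAlgebra.ι R i * FreeAlgebra.ι R j * FreeAlgebra.ι R i)
        (FreeAlgebra.ι R j * FreeAlgebra.ι R i * FreeAlgebra.ι R j)
  | comm (i j : Fin (n - 1)) (h : (i : ℕ) + 1 < j) :
      HeckeRel R n (FreeAlgebra.ι R i * FreeAlgebra.ι R j)
        (FreeAlgebra.ι R j * FreeAlgebra.ι R i)

/-- The `0`-Hecke algebra `H_n(0)` over `R`. -/
def ZeroHecke (R : Type*) [CommRing R] (n : ℕ) : Type _ := RingQuot (HeckeRel R n)

instance (R : Type*) [CommRing R] (n : ℕ) : Ring (ZeroHecke R n) :=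
  inferInstanceAs (Ring (RingQuot (HeckeRel R n)))

instance (R : Type*) [CommRing R] (n : ℕ) : Algebra R (ZeroHecke R n) :=
  inferInstanceAs (Algebra R (RingQuot (HeckeRel R n)))

/-- The generator `T_i` of `H_n(0)`. -/
def T (R : Type*) [CommRing R] {n : ℕ} (i : Fin (n - 1)) : ZeroHecke R n :=
  RingQuot.mkAlgHom R (HeckeRel R n) (FreeAlgebra.ι R i)

/-- The generator `T'_i = T_i + 1` of `H_n(0)`. -/
def T' (R : Type*) [CommRing R] {n : ℕ} (i : Fin (n - 1)) : ZeroHecke R n := T R i + 1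

/-- `T_w = T_{i_1} ⋯ T_{i_k}` for a reduced expression `w = s_{i_1} ⋯ s_{i_k}`. -/
def Tw (R : Type*) [CommRing R] {n : ℕ} (w : Perm (Fin n)) : ZeroHecke R n :=
  ((reducedWord w).map (T R)).prod

/-- `T'_w = T'_{i_1} ⋯ T'_{i_k}` for a reduced expression `w = s_{i_1} ⋯ s_{i_k}`. -/
def Tw' (R : Type*) [CommRing R] {n : ℕ} (w : Perm (Fin n)) : ZeroHecke R n :=
  ((reducedWord w).map (T' R)).prod

/-- Norton's left ideal `P_α = H_n(0) · T_{w₀(α)} T'_{w₀(αᶜ)}`. Here `w₀(α)` is the longest element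
of the parabolic subgroup attached to `D(α)`, and `αᶜ` is the composition of `n` whose descent set
is the complement of `D(α)` in `[n - 1]`. -/
def P (R : Type*) [CommRing R] {n : ℕ} (α : Composition n) :
    Submodule (ZeroHecke R n) (ZeroHecke R n) :=
  Submodule.span (ZeroHecke R n) {Tw R (w₀ (compDescentSet α)) * Tw' R (w₀ (compDescentSet α)ᶜ)}

/-- A module is indecomposable if it is nonzero and is not the direct sum of two nonzero
submodules. -/
def IsIndecomposable (A M : Type*) [Ring A] [AddCommGroup M] [Module A M] : Prop :=
  Nontrivial M ∧ ∀ N K : Submodule A M, IsCompl N K → N = ⊥ ∨ K = ⊥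

/-! ### Demazure operators -/

section Demazure

variable {R : Type*} [CommRing R] {n : ℕ}

/-- The action of `s_i` on polynomials, permuting the variables. -/
def act (i : Fin (n - 1)) : MvPolynomial (Fin n) R →ₐ[R] MvPolynomial (Fin n) R :=
  MvPolynomial.rename (s i)

theorem act_X (i : Fin (n - 1)) (j : Fin n) :
    act i (MvPolynomial.X j : MvPolynomial (Fin n) R) = MvPolynomial.X (s i j) := by
  simp [act]

theorem sub_dvd_sub_act (i : Fin (n - 1)) (f : MvPolynomial (Fin n) R) :
    (MvPolynomial.X (lo i) - MvPolynomial.X (hi i) : MvPolynomial (Fin n) R) ∣ f - act i f := by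
  induction f using MvPolynomial.induction_on with
  | C a => simp [act]
  | add p q hp hq =>
    rw [map_add, add_sub_add_comm]
    exact dvd_add hp hq
  | mul_X p j hp =>
    have hX : (MvPolynomial.X (lo i) - MvPolynomial.X (hi i) : MvPolynomial (Fin n) R) ∣
        MvPolynomial.X j - MvPolynomial.X (s i j) := by
      unfold s
      rcases eq_or_ne j (lo i) with rfl | h1
      · simp
      rcases eq_or_ne j (hi i) with rfl | h2
      · rw [Equiv.swap_apply_right]
        exact ⟨-1, by ring⟩
      · simp [Equiv.swap_apply_of_ne_of_ne h1 h2]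
    have : p * MvPolynomial.X j - act i (p * MvPolynomial.X j) =
        (p - act i p) * MvPolynomial.X j
          + act i p * (MvPolynomial.X j - MvPolynomial.X (s i j)) := by
      rw [map_mul, act_X]; ring
    rw [this]
    exact dvd_add (hp.mul_right _) (hX.mul_left _)

theorem demazure_dvd (i : Fin (n - 1)) (f : MvPolynomial (Fin n) R) :
    (MvPolynomial.X (lo i) - MvPolynomial.X (hi i) : MvPolynomial (Fin n) R) ∣
      MvPolynomial.X (lo i) * f - MvPolynomial.X (hi i) * act i f := by
  have : MvPolynomial.X (lo i) * f - MvPolynomial.X (hi i) * act i f =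
      MvPolynomial.X (lo i) * (f - act i f)
        + (MvPolynomial.X (lo i) - MvPolynomial.X (hi i)) * act i f := by ring
  rw [this]
  exact dvd_add ((sub_dvd_sub_act i f).mul_left _) (dvd_mul_right _ _)

theorem X_sub_X_ne_zero [Nontrivial R] {a b : Fin n} (h : a ≠ b) :
    (MvPolynomial.X a - MvPolynomial.X b : MvPolynomial (Fin n) R) ≠ 0 :=
  sub_ne_zero.2 fun e => h (MvPolynomial.X_injective e)

/-- The quotient `(x_i f - x_{i+1} s_i(f)) / (x_i - x_{i+1})`. -/
def demazureFun (i : Fin (n - 1)) (f : MvPolynomial (Fin n) R) : MvPolynomial (Fin n) R :=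
  Classical.choose (demazure_dvd i f)

theorem demazureFun_spec (i : Fin (n - 1)) (f : MvPolynomial (Fin n) R) :
    (MvPolynomial.X (lo i) - MvPolynomial.X (hi i)) * demazureFun i f =
      MvPolynomial.X (lo i) * f - MvPolynomial.X (hi i) * act i f :=
  (Classical.choose_spec (demazure_dvd i f)).symm

variable [IsDomain R]

theorem eq_demazureFun (i : Fin (n - 1)) {f g : MvPolynomial (Fin n) R}
    (h : (MvPolynomial.X (lo i) - MvPolynomial.X (hi i)) * g =
      MvPolynomial.X (lo i) * f - MvPolynomial.X (hi i) * act i f) : demazureFun i f = g :=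
  mul_left_cancel₀ (X_sub_X_ne_zero (lo_ne_hi i)) ((demazureFun_spec i f).trans h.symm)

/-- The Demazure operator `π_i f = (x_i f - x_{i+1} s_i(f)) / (x_i - x_{i+1})`. -/
def demazure (i : Fin (n - 1)) : MvPolynomial (Fin n) R →ₗ[R] MvPolynomial (Fin n) R where
  toFun := demazureFun i
  map_add' f g := eq_demazureFun i (by
    rw [mul_add, demazureFun_spec, demazureFun_spec, map_add]; ring)
  map_smul' c f := eq_demazureFun i (by
    rw [RingHom.id_apply, mul_smul_comm, demazureFun_spec, map_smul, smul_sub, mul_smul_comm,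
      mul_smul_comm])

theorem demazure_spec (i : Fin (n - 1)) (f : MvPolynomial (Fin n) R) :
    (MvPolynomial.X (lo i) - MvPolynomial.X (hi i)) * demazure i f =
      MvPolynomial.X (lo i) * f - MvPolynomial.X (hi i) * act i f :=
  demazureFun_spec i f

theorem demazure_mul_of_act_eq (i : Fin (n - 1)) (f g : MvPolynomial (Fin n) R)
    (hf : act i f = f) : demazure i (f * g) = f * demazure i g :=
  eq_demazureFun i (by
    rw [mul_left_comm, demazure_spec, map_mul, hf]; ring)

/-- The operator `π̄_i = π_i - 1`. -/
def demazureBar (R : Type*) [CommRing R] [IsDomain R] {n : ℕ} (i : Fin (n - 1)) :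
    Module.End R (MvPolynomial (Fin n) R) :=
  demazure i - 1

/-- `π̄_w = π̄_{i_1} ⋯ π̄_{i_k}` for a reduced expression `w = s_{i_1} ⋯ s_{i_k}`. -/
def demazureBarW (R : Type*) [CommRing R] [IsDomain R] {n : ℕ} (w : Perm (Fin n)) :
    Module.End R (MvPolynomial (Fin n) R) :=
  ((reducedWord w).map (demazureBar R)).prod

end Demazure

/-- The monomial `x_I = ∏_{i ∈ I} x_1 ⋯ x_i`. -/
def xSet (R : Type*) [CommRing R] {n : ℕ} (I : Finset (Fin (n - 1))) : MvPolynomial (Fin n) R :=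
  ∏ i ∈ I, ∏ j ∈ Finset.Iic (lo i), MvPolynomial.X j

/-! ### The `0`-Hecke relations for the operators `π̄_i` -/

section Relations

variable {R : Type*} [CommRing R] [IsDomain R] {n : ℕ}

theorem act_demazure (i : Fin (n - 1)) (f : MvPolynomial (Fin n) R) :
    act i (demazure i f) = demazure i f := by
  have h := congrArg (act i) (demazure_spec i f)
  have hh : act i (act i f) = f := by
    simp only [act, MvPolynomial.rename_rename]
    have : (s i : Fin n → Fin n) ∘ s i = id := by ext x; simp [s]
    rw [this, MvPolynomial.rename_id_apply]
  simp only [map_mul, map_sub, act_X, hh] at h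
  have h1 : s i (lo i) = hi i := by simp [s]
  have h2 : s i (hi i) = lo i := by simp [s]
  rw [h1, h2] at h
  refine mul_left_cancel₀ (X_sub_X_ne_zero (lo_ne_hi i)) ?_
  linear_combination -h - demazure_spec i f

theorem demazure_idem (i : Fin (n - 1)) (f : MvPolynomial (Fin n) R) :
    demazure i (demazure i f) = demazure i f :=
  eq_demazureFun i (by rw [act_demazure]; ring)

theorem demazure_comm (i j : Fin (n - 1)) (h : (i : ℕ) + 1 < j) (f : MvPolynomial (Fin n) R) :
    demazure i (demazure j f) = demazure j (demazure i f) := by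
  have e1 : s i (lo j) = lo j := by
    apply Equiv.swap_apply_of_ne_of_ne <;> simp [lo, hi, Fin.ext_iff] <;> omega
  have e2 : s i (hi j) = hi j := by
    apply Equiv.swap_apply_of_ne_of_ne <;> simp [lo, hi, Fin.ext_iff] <;> omega
  have e3 : s j (lo i) = lo i := by
    apply Equiv.swap_apply_of_ne_of_ne <;> simp [lo, hi, Fin.ext_iff] <;> omega
  have e4 : s j (hi i) = hi i := by
    apply Equiv.swap_apply_of_ne_of_ne <;> simp [lo, hi, Fin.ext_iff] <;> omega
  have hc : act i (act j f) = act j (act i f) := by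
    simp only [act, MvPolynomial.rename_rename]
    congr 2
    have : s i * s j = s j * s i := by
      apply Equiv.Perm.Disjoint.commute
      apply Equiv.Perm.disjoint_swap_swap
      simp [lo, hi, Fin.ext_iff]
      omega
    exact congrArg (fun p : Perm (Fin n) => (p : Fin n → Fin n)) this
  have a1 := demazure_spec i (demazure j f)
  have a2 := demazure_spec j f
  have a3 := congrArg (act i) a2
  have b1 := demazure_spec j (demazure i f)
  have b2 := demazure_spec i f
  have b3 := congrArg (act j) b2
  simp only [map_mul, map_sub, act_X, e1, e2, e3, e4, hc] at a3 b3
  refine mul_left_cancel₀ (X_sub_X_ne_zero (lo_ne_hi i)) ?_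
  refine mul_left_cancel₀ (X_sub_X_ne_zero (lo_ne_hi j)) ?_
  linear_combination
    (MvPolynomial.X (lo j) - MvPolynomial.X (hi j)) * a1 + MvPolynomial.X (lo i) * a2
      - MvPolynomial.X (hi i) * a3
      - (MvPolynomial.X (lo i) - MvPolynomial.X (hi i)) * b1 - MvPolynomial.X (lo j) * b2
      + MvPolynomial.X (hi j) * b3

theorem demazure_braid (i j : Fin (n - 1)) (h : (i : ℕ) + 1 = j) (f : MvPolynomial (Fin n) R) :
    demazure i (demazure j (demazure i f)) = demazure j (demazure i (demazure j f)) := by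
  have hij : hi i = lo j := by simp [lo, hi, h]
  have hac : lo i ≠ hi j := by simp [lo, hi, Fin.ext_iff]; omega
  have hab : lo i ≠ lo j := by simp [lo, Fin.ext_iff]; omega
  have hbc := lo_ne_hi j
  have e1 : s i (lo i) = lo j := by simp [s, hij]
  have e2 : s i (lo j) = lo i := by simp [s, hij]
  have e3 : s i (hi j) = hi j := by
    rw [s, hij]; exact Equiv.swap_apply_of_ne_of_ne hac.symm hbc.symm
  have e4 : s j (lo i) = lo i := Equiv.swap_apply_of_ne_of_ne hab hac
  have e5 : s j (lo j) = hi j := by simp [s]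
  have e6 : s j (hi j) = lo j := by simp [s]
  have hsts : act i (act j (act i f)) = act j (act i (act j f)) := by
    simp only [act, MvPolynomial.rename_rename]
    congr 2
    funext x
    simp only [Function.comp_apply]
    rcases eq_or_ne x (lo i) with rfl | h1
    · simp only [e1, e3, e4, e5]
    rcases eq_or_ne x (lo j) with rfl | h2
    · simp only [e1, e2, e3, e4, e5, e6]
    rcases eq_or_ne x (hi j) with rfl | h3
    · simp only [e1, e2, e3, e4, e5, e6]
    have g1 : s i x = x := Equiv.swap_apply_of_ne_of_ne h1 (hij ▸ h2)
    have g2 : s j x = x := Equiv.swap_apply_of_ne_of_ne h2 h3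
    simp only [g1, g2]
  have a1 := demazure_spec i (demazure j (demazure i f))
  have a2 := demazure_spec j (demazure i f)
  have a3 := congrArg (act i) a2
  have a4 := demazure_spec i f
  have a5 := congrArg (act j) a4
  have a6 := congrArg (act i) a5
  have b1 := demazure_spec j (demazure i (demazure j f))
  have b2 := demazure_spec i (demazure j f)
  have b3 := congrArg (act j) b2
  have b4 := demazure_spec j f
  have b5 := congrArg (act i) b4
  have b6 := congrArg (act j) b5
  simp only [map_mul, map_sub, act_X, hij, e1, e2, e3, e4, e5, e6, hsts, act_demazure]
    at a1 a2 a3 a4 a5 a6 b1 b2 b3 b4 b5 b6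
  refine mul_left_cancel₀ (X_sub_X_ne_zero hab) (mul_left_cancel₀ (X_sub_X_ne_zero hbc)
    (mul_left_cancel₀ (X_sub_X_ne_zero hac) ?_))
  generalize (MvPolynomial.X (lo i) : MvPolynomial (Fin n) R) = a at *
  generalize (MvPolynomial.X (lo j) : MvPolynomial (Fin n) R) = b at *
  generalize (MvPolynomial.X (hi j) : MvPolynomial (Fin n) R) = c at *
  linear_combination (b - c) * (a - c) * a1 + a * (a - c) * a2 - b * (b - c) * a3 + a * b * a4
    - a * c * a5 + b * c * a6 - (a - b) * (a - c) * b1 - b * (a - c) * b2 + c * (a - b) * b3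
    - a ^ 2 * b4 + b ^ 2 * b5 - c ^ 2 * b6

theorem demazureBar_quad (i : Fin (n - 1)) :
    demazureBar R i * demazureBar R i = -demazureBar R i := by
  have h : (demazure i * demazure i : Module.End R (MvPolynomial (Fin n) R)) = demazure i :=
    LinearMap.ext (demazure_idem i)
  simp only [demazureBar, sub_mul, mul_sub, one_mul, mul_one, h]
  abel

theorem demazureBar_comm (i j : Fin (n - 1)) (hij : (i : ℕ) + 1 < j) :
    demazureBar R i * demazureBar R j = demazureBar R j * demazureBar R i := by
  have h : (demazure i * demazure j : Module.End R (MvPolynomial (Fin n) R)) =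
      demazure j * demazure i := LinearMap.ext (demazure_comm i j hij)
  simp only [demazureBar, sub_mul, mul_sub, one_mul, mul_one, h]
  abel

theorem demazureBar_braid (i j : Fin (n - 1)) (hij : (i : ℕ) + 1 = j) :
    demazureBar R i * demazureBar R j * demazureBar R i =
      demazureBar R j * demazureBar R i * demazureBar R j := by
  have h : (demazure i * demazure j * demazure i : Module.End R (MvPolynomial (Fin n) R)) =
      demazure j * demazure i * demazure j := LinearMap.ext (demazure_braid i j hij)
  have h1 : (demazure i * demazure i : Module.End R (MvPolynomial (Fin n) R)) = demazure i :=
    LinearMap.ext (demazure_idem i)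
  have h2 : (demazure j * demazure j : Module.End R (MvPolynomial (Fin n) R)) = demazure j :=
    LinearMap.ext (demazure_idem j)
  simp only [demazureBar, sub_mul, mul_sub, one_mul, mul_one, h, h1, h2]
  abel

end Relations

/-! ### The coinvariant algebra and the action of `H_n(0)` on it -/

/-- The ideal generated by the symmetric polynomials without constant term. -/
def coinvIdeal (R : Type*) [CommRing R] (n : ℕ) : Ideal (MvPolynomial (Fin n) R) :=
  Ideal.span {f | f.IsSymmetric ∧ MvPolynomial.constantCoeff f = 0}

/-- The coinvariant algebra `R[x_1, …, x_n] / (R[x]^{𝔖_n}_+)`. -/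
def CoinvAlg (R : Type*) [CommRing R] (n : ℕ) : Type _ :=
  MvPolynomial (Fin n) R ⧸ coinvIdeal R n

instance (R : Type*) [CommRing R] (n : ℕ) : CommRing (CoinvAlg R n) :=
  inferInstanceAs (CommRing (MvPolynomial (Fin n) R ⧸ coinvIdeal R n))

instance (R : Type*) [CommRing R] (n : ℕ) : Algebra R (CoinvAlg R n) :=
  inferInstanceAs (Algebra R (MvPolynomial (Fin n) R ⧸ coinvIdeal R n))

/-- The quotient map from polynomials to the coinvariant algebra. -/
def toCoinv (R : Type*) [CommRing R] (n : ℕ) : MvPolynomial (Fin n) R →ₐ[R] CoinvAlg R n :=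
  Ideal.Quotient.mkₐ R (coinvIdeal R n)

section Action

variable {R : Type*} [CommRing R] {n : ℕ}

theorem toCoinv_surjective : Function.Surjective (toCoinv R n) :=
  Ideal.Quotient.mkₐ_surjective R (coinvIdeal R n)

theorem toCoinv_eq_zero_iff (f : MvPolynomial (Fin n) R) :
    toCoinv R n f = 0 ↔ f ∈ coinvIdeal R n :=
  Ideal.Quotient.eq_zero_iff_mem

variable [IsDomain R]

theorem demazure_mem (i : Fin (n - 1)) {f : MvPolynomial (Fin n) R} (hf : f ∈ coinvIdeal R n) :
    demazure i f ∈ coinvIdeal R n := by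
  have key : ∀ p : MvPolynomial (Fin n) R, demazure i (f * p) ∈ coinvIdeal R n := by
    unfold coinvIdeal at hf
    induction hf using Submodule.span_induction with
    | mem g hg =>
      intro p
      rw [demazure_mul_of_act_eq i g p (hg.1 (s i))]
      exact Ideal.mul_mem_right _ _ (Ideal.subset_span hg)
    | zero => intro p; simp
    | add x y _ _ hx hy => intro p; rw [add_mul, map_add]; exact add_mem (hx p) (hy p)
    | smul a x _ hx => intro p; rw [smul_eq_mul, mul_comm a, mul_assoc]; exact hx _
  simpa using key 1

theorem demazureBar_mem (i : Fin (n - 1)) {f : MvPolynomial (Fin n) R}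
    (hf : f ∈ coinvIdeal R n) : demazureBar R i f ∈ coinvIdeal R n :=
  sub_mem (demazure_mem i hf) hf

theorem exists_coinvBar (i : Fin (n - 1)) : ∃ φ : Module.End R (CoinvAlg R n),
    ∀ f, φ (toCoinv R n f) = toCoinv R n (demazureBar R i f) := by
  have hs : ∀ x : CoinvAlg R n, ∃ f, toCoinv R n f = x := toCoinv_surjective
  choose g hg using hs
  have key : ∀ f f' : MvPolynomial (Fin n) R, toCoinv R n f = toCoinv R n f' →
      toCoinv R n (demazureBar R i f) = toCoinv R n (demazureBar R i f') := by
    intro f f' h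
    rw [← sub_eq_zero, ← map_sub, toCoinv_eq_zero_iff] at h ⊢
    rw [← map_sub]
    exact demazureBar_mem i h
  refine ⟨{ toFun := fun x => toCoinv R n (demazureBar R i (g x))
            map_add' := fun x y => ?_
            map_smul' := fun c x => ?_ }, fun f => key _ _ (hg _)⟩
  · rw [← map_add, ← map_add]
    exact key _ _ (by rw [map_add, hg, hg, hg])
  · rw [RingHom.id_apply, ← map_smul, ← map_smul]
    exact key _ _ (by rw [map_smul, hg, hg])

/-- The operator on the coinvariant algebra induced by `π̄_i`. -/
def coinvBar (R : Type*) [CommRing R] [IsDomain R] {n : ℕ} (i : Fin (n - 1)) :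
    Module.End R (CoinvAlg R n) :=
  Classical.choose (exists_coinvBar i)

theorem coinvBar_toCoinv (i : Fin (n - 1)) (f : MvPolynomial (Fin n) R) :
    coinvBar R i (toCoinv R n f) = toCoinv R n (demazureBar R i f) :=
  Classical.choose_spec (exists_coinvBar i) f

/-- The representation `T_i ↦ π̄_i` of `H_n(0)` on the coinvariant algebra. -/
def heckeRep (R : Type*) [CommRing R] [IsDomain R] (n : ℕ) :
    ZeroHecke R n →ₐ[R] Module.End R (CoinvAlg R n) :=
  RingQuot.liftAlgHom R ⟨FreeAlgebra.lift R (coinvBar R), by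
    intro x y h
    induction h with
    | quad i =>
      simp only [map_mul, map_neg, FreeAlgebra.lift_ι_apply]
      refine LinearMap.ext fun v => ?_
      obtain ⟨f, rfl⟩ := toCoinv_surjective v
      have := congrArg (toCoinv R n) (LinearMap.congr_fun (demazureBar_quad (R := R) i) f)
      simpa [coinvBar_toCoinv] using this
    | braid i j hij =>
      simp only [map_mul, FreeAlgebra.lift_ι_apply]
      refine LinearMap.ext fun v => ?_
      obtain ⟨f, rfl⟩ := toCoinv_surjective v
      have := congrArg (toCoinv R n) (LinearMap.congr_fun (demazureBar_braid (R := R) i j hij) f)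
      simpa [coinvBar_toCoinv] using this
    | comm i j hij =>
      simp only [map_mul, FreeAlgebra.lift_ι_apply]
      refine LinearMap.ext fun v => ?_
      obtain ⟨f, rfl⟩ := toCoinv_surjective v
      have := congrArg (toCoinv R n) (LinearMap.congr_fun (demazureBar_comm (R := R) i j hij) f)
      simpa [coinvBar_toCoinv] using this⟩

instance : Module (ZeroHecke R n) (CoinvAlg R n) :=
  Module.compHom (CoinvAlg R n) (heckeRep R n).toRingHom

theorem hecke_smul_def (h : ZeroHecke R n) (x : CoinvAlg R n) : h • x = heckeRep R n h x := rfl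

theorem T_smul (i : Fin (n - 1)) (f : MvPolynomial (Fin n) R) :
    T R i • toCoinv R n f = toCoinv R n (demazure i f - f) := by
  have h : heckeRep R n (T R i) = coinvBar R i := by
    have h1 := RingQuot.liftAlgHom_mkAlgHom_apply R (FreeAlgebra.lift R (coinvBar R (n := n)))
      (s := HeckeRel R n)
    unfold heckeRep T
    exact (h1 _ _).trans (by simp)
  rw [hecke_smul_def, h, coinvBar_toCoinv]
  rfl

instance : IsScalarTower R (ZeroHecke R n) (CoinvAlg R n) where
  smul_assoc r h x := by
    rw [hecke_smul_def, hecke_smul_def, map_smul]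
    rfl

/-- The image of `π̄_w x_I` in the coinvariant algebra. -/
def atom (R : Type*) [CommRing R] [IsDomain R] {n : ℕ} (w : Perm (Fin n))
    (I : Finset (Fin (n - 1))) : CoinvAlg R n :=
  toCoinv R n (demazureBarW R w (xSet R I))

/-- The submodule `H_n(0) · π̄_{w₀(α)} x_{D(α)}` of the coinvariant algebra. -/
def summand (R : Type*) [CommRing R] [IsDomain R] {n : ℕ} (α : Composition n) :
    Submodule (ZeroHecke R n) (CoinvAlg R n) :=
  Submodule.span (ZeroHecke R n) {atom R (w₀ (compDescentSet α)) (compDescentSet α)}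

end Action

end Coinv

end

/-!
The proof exhibits `C_n` and `H_n(0)` as modules with one and the same structure. Call a basis of an
`H_n(0)`-module indexed by permutations a descent basis if it has the form `b_w = T_w m_{D(w)}`,
where `T_i m_I = 0` for `i ∉ I` (`IsDescentBasis`). The action on such a basis is forced:
`T_i b_w` is `-b_w` if `i` is a left descent of `w`, it is `b_{s_i w}` if `s_i w` is longer than `w`
and has the same descents, and it is `0` otherwise, because then `s_i w` has a descent `j ∉ D(w)`
and `T_{s_i w}` ends in `T_j`. Hence two modules with descent bases are isomorphic
(`IsDescentBasis.equiv`), the vectors `b_w` with `D(w) = I` span the submodule generated by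
`T_{w₀(I)} m_I` (`IsDescentBasis.mem_span_singleton_iff`), and these submodules decompose the module
(`IsDescentBasis.isInternal`).

For `H_n(0)` one takes `m_I = T'_{w₀(Iᶜ)}`. The product `T_w T'_{w₀(D(w)ᶜ)}` is `T_w` plus longer
terms, and the `T_w` are a basis: they span by Matsumoto's theorem (`IsBraided.prod_eq`), and they
are independent because their images of `x_{[n-1]}` in the polynomial ring have different leading
monomials. So the left ideals generated by the `T_{w₀(I)} m_I` are Norton's `P_α`.

For `C_n` one takes `m_I = x_I`, so that the claim to be shown is that the Demazure atoms form a
basis. Monomials are ordered by the largest weight `∑ a_{σ(i)} (n + 1 - i)` of a rearrangement of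
their exponent, and then by the number of rises of the exponent (`rank`). If the descents of `w` lie
in `I`, then `π̄_w x_I` is `w x_I` plus terms of smaller largest weight (`demazureBarW_sub_mem`).
For a partition `ν` with monomial symmetric polynomial `m_ν`, the leading monomial of
`π̄_w x_{D(w)} m_ν` has the exponent `w (λ_{D(w)} + ν)`, where `λ_{D(w)}` is the exponent of
`x_{D(w)}` (`atomMul_sub_mem`). Stable sorting shows that every exponent has this form for exactly
one pair `(w, ν)`, so these products are an `R`-basis of the polynomial ring (`atomMulBasis`). Those
with `ν ≠ 0` span the ideal defining the coinvariant algebra (`mem_coinvIdeal_iff`), and those with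
`ν = 0` are the atoms.

The ideal `P_α` is projective as a direct summand of `H_n(0)`. It is indecomposable by an argument
on idempotents: left multiplication on the `T_w` is triangular, and its diagonal consists of values
of the characters `T_i ↦ -1` (`i ∈ A`), `T_i ↦ 0` (`i ∉ A`), so a nonzero idempotent takes the value
`1` under some character (`idempotent_eq_zero`). On `P_α` all characters with `A ≠ D(α)` vanish, and
the remaining one cannot be `1` on two orthogonal idempotents (`isIndecomposable_of_character`).
-/

noncomputable section

namespace Coinv

/-! ### Length and descents of permutations -/

section Perm

variable {n : ℕ}

theorem s_val (i : Fin (n - 1)) (x : Fin n) :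
    (s i x : ℕ) = if (x : ℕ) = i then (i : ℕ) + 1 else if (x : ℕ) = i + 1 then (i : ℕ) else x := by
  unfold s
  rw [Equiv.swap_apply_def]
  split_ifs <;> simp_all [lo, hi, Fin.ext_iff]

theorem s_apply_of_ne {i : Fin (n - 1)} {x : Fin n} (h1 : (x : ℕ) ≠ i) (h2 : (x : ℕ) ≠ i + 1) :
    s i x = x := by
  rw [Fin.ext_iff, s_val, if_neg h1, if_neg h2]

theorem s_mul_self (i : Fin (n - 1)) : s i * s i = (1 : Perm (Fin n)) := Equiv.swap_mul_self _ _

theorem s_inv (i : Fin (n - 1)) : (s i : Perm (Fin n))⁻¹ = s i := Equiv.swap_inv _ _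

theorem s_mul_s_mul (i : Fin (n - 1)) (w : Perm (Fin n)) : s i * (s i * w) = w := by
  rw [← mul_assoc, s_mul_self, one_mul]

theorem mul_s_mul_s (i : Fin (n - 1)) (w : Perm (Fin n)) : w * s i * s i = w := by
  rw [mul_assoc, s_mul_self, mul_one]

theorem s_lo (i : Fin (n - 1)) : s i (lo i) = hi i := Equiv.swap_apply_left _ _

theorem s_hi (i : Fin (n - 1)) : s i (hi i) = lo i := Equiv.swap_apply_right _ _

theorem lo_lt_hi (i : Fin (n - 1)) : lo i < hi i := by simp [lo, hi, Fin.lt_def]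

theorem mem_descentSet {w : Perm (Fin n)} {i : Fin (n - 1)} :
    i ∈ descentSet w ↔ w (hi i) < w (lo i) := by
  simp [descentSet]

theorem lt_of_notMem_descentSet {w : Perm (Fin n)} {i : Fin (n - 1)} (h : i ∉ descentSet w) :
    w (lo i) < w (hi i) := by
  rw [mem_descentSet, not_lt] at h
  exact lt_of_le_of_ne h fun e => lo_ne_hi i (w.injective e)

theorem mem_descentSet_mul_s {w : Perm (Fin n)} {i : Fin (n - 1)} :
    i ∈ descentSet (w * s i) ↔ i ∉ descentSet w := by
  refine ⟨fun h h' => ?_, fun h => ?_⟩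
  · rw [mem_descentSet, Perm.mul_apply, Perm.mul_apply, s_lo, s_hi] at h
    exact lt_asymm h (mem_descentSet.1 h')
  · rw [mem_descentSet, Perm.mul_apply, Perm.mul_apply, s_lo, s_hi]
    exact lt_of_notMem_descentSet h

theorem mem_descentSet_inv_s_mul {w : Perm (Fin n)} {i : Fin (n - 1)} :
    i ∈ descentSet (s i * w)⁻¹ ↔ i ∉ descentSet w⁻¹ := by
  rw [mul_inv_rev, s_inv, mem_descentSet_mul_s]

/-- The inversions of a permutation, as pairs of positions. -/
def inversions (w : Perm (Fin n)) : Finset (Fin n × Fin n) :=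
  Finset.univ.filter fun p => p.1 < p.2 ∧ w p.2 < w p.1

theorem mem_inversions {w : Perm (Fin n)} {p : Fin n × Fin n} :
    p ∈ inversions w ↔ p.1 < p.2 ∧ w p.2 < w p.1 := by
  simp [inversions]

/-- An adjacent transposition preserves the order of every pair of points except the one it
exchanges. -/
theorem s_lt_s {i : Fin (n - 1)} {p q : Fin n} (h : p < q) (hne : ¬ (p = lo i ∧ q = hi i)) :
    s i p < s i q := by
  rw [Fin.lt_def, s_val, s_val]
  rw [Fin.lt_def] at h
  have : ¬ ((p : ℕ) = i ∧ (q : ℕ) = i + 1) := by simpa [lo, hi, Fin.ext_iff] using hne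
  split_ifs <;> omega

/-- The inversions of `w s_i` are `(i, i + 1)` and the images under `s_i` of those of `w`. -/
theorem card_inversions_mul_s {w : Perm (Fin n)} {i : Fin (n - 1)} (h : i ∉ descentSet w) :
    (inversions (w * s i)).card = (inversions w).card + 1 := by
  have hinj : Function.Injective (Prod.map (s i) (s i) : Fin n × Fin n → Fin n × Fin n) :=
    (s i).injective.prodMap (s i).injective
  have hw := lt_of_notMem_descentSet h
  have hss : ∀ x : Fin n, s i (s i x) = x := fun x => by
    rw [← Perm.mul_apply, s_mul_self, Perm.one_apply]
  have hnot : (lo i, hi i) ∉ (inversions w).image (Prod.map (s i) (s i)) := by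
    simp only [Finset.mem_image, mem_inversions, Prod.exists, Prod.map_apply,
      Prod.mk.injEq, not_exists]
    rintro a b ⟨⟨h1, h2⟩, h3, h4⟩
    have ha : a = hi i := by rw [← hss a, h3, s_lo]
    have hb : b = lo i := by rw [← hss b, h4, s_hi]
    subst ha hb
    exact lt_asymm h1 (lo_lt_hi i)
  rw [← Finset.card_image_of_injective (inversions w) hinj, ← Finset.card_insert_of_notMem hnot]
  congr 1
  ext ⟨p, q⟩
  simp only [Finset.mem_insert, Finset.mem_image, mem_inversions, Prod.exists, Prod.map_apply,
    Prod.mk.injEq, Perm.mul_apply]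
  constructor
  · rintro ⟨h1, h2⟩
    by_cases hpq : p = lo i ∧ q = hi i
    · exact Or.inl hpq
    · exact Or.inr ⟨s i p, s i q, ⟨s_lt_s h1 hpq, h2⟩, hss _, hss _⟩
  · rintro (⟨rfl, rfl⟩ | ⟨a, b, ⟨h1, h2⟩, rfl, rfl⟩)
    · rw [s_lo, s_hi]
      exact ⟨lo_lt_hi i, hw⟩
    · rw [hss, hss]
      refine ⟨s_lt_s h1 ?_, h2⟩
      rintro ⟨rfl, rfl⟩
      exact lt_asymm h2 hw

theorem eq_one_of_descentSet_eq_empty {w : Perm (Fin n)} (h : descentSet w = ∅) : w = 1 := by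
  rw [← Equiv.Perm.monotone_iff]
  cases n with
  | zero => intro a; exact a.elim0
  | succ m =>
    apply Monotone.comp (g := id) monotone_id
    rw [Fin.monotone_iff_le_succ]
    intro i
    have : (i : Fin (m + 1 - 1)) ∉ descentSet w := by simp [h]
    exact (lt_of_notMem_descentSet this).le

theorem card_inversions_prod_le (l : List (Fin (n - 1))) :
    (inversions (l.map s).prod).card ≤ l.length := by
  induction l using List.reverseRecOn with
  | nil => simp [inversions, Finset.filter_eq_empty_iff]; intro a b h; exact h.le
  | append_singleton l i ih =>
    rw [List.map_append, List.prod_append, List.length_append]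
    simp only [List.map_cons, List.map_nil, List.prod_singleton, List.length_singleton]
    by_cases h : i ∈ descentSet (l.map s).prod
    · have := card_inversions_mul_s (fun h' => mem_descentSet_mul_s.1 h' h)
      rw [mul_s_mul_s] at this
      omega
    · rw [card_inversions_mul_s h]
      omega

theorem exists_word_length_eq_card_inversions (w : Perm (Fin n)) :
    ∃ l : List (Fin (n - 1)), (l.map s).prod = w ∧ l.length = (inversions w).card := by
  induction hk : (inversions w).card generalizing w with
  | zero =>
    refine ⟨[], (eq_one_of_descentSet_eq_empty ?_).symm, rfl⟩
    rw [Finset.eq_empty_iff_forall_notMem]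
    intro i hi'
    have : (lo i, hi i) ∈ inversions w := mem_inversions.2 ⟨lo_lt_hi i, mem_descentSet.1 hi'⟩
    rw [Finset.card_eq_zero] at hk
    simp [hk] at this
  | succ k ih =>
    have : descentSet w ≠ ∅ := by
      intro h
      rw [eq_one_of_descentSet_eq_empty h] at hk
      have := card_inversions_prod_le (n := n) []
      simp only [List.map_nil, List.prod_nil, List.length_nil] at this
      omega
    obtain ⟨i, hi'⟩ := Finset.nonempty_iff_ne_empty.2 this
    have h1 := card_inversions_mul_s (fun h' => mem_descentSet_mul_s.1 h' hi')
    rw [mul_s_mul_s] at h1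
    obtain ⟨l, hl, hl'⟩ := ih (w * s i) (by omega)
    exact ⟨l ++ [i], by simp [hl, mul_s_mul_s], by simp [hl']⟩

theorem len_eq_card_inversions (w : Perm (Fin n)) : len w = (inversions w).card := by
  obtain ⟨l, hl, hl'⟩ := exists_word_length_eq_card_inversions w
  refine le_antisymm (hl' ▸ (isReducedWord_reducedWord w).2 l hl) ?_
  have := card_inversions_prod_le (reducedWord w)
  rwa [(isReducedWord_reducedWord w).1] at this

theorem isReducedWord_iff {w : Perm (Fin n)} {l : List (Fin (n - 1))} :
    IsReducedWord w l ↔ (l.map s).prod = w ∧ l.length = len w := by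
  have hr := isReducedWord_reducedWord w
  refine ⟨fun h => ⟨h.1, le_antisymm (h.2 _ hr.1) (hr.2 _ h.1)⟩, fun h => ⟨h.1, fun l' hl' => ?_⟩⟩
  rw [h.2]
  exact hr.2 l' hl'

theorem len_mul_s {w : Perm (Fin n)} {i : Fin (n - 1)} (h : i ∉ descentSet w) :
    len (w * s i) = len w + 1 := by
  rw [len_eq_card_inversions, len_eq_card_inversions, card_inversions_mul_s h]

theorem len_mul_s_add_one {w : Perm (Fin n)} {i : Fin (n - 1)} (h : i ∈ descentSet w) :
    len (w * s i) + 1 = len w := by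
  rw [← len_mul_s fun h' => mem_descentSet_mul_s.1 h' h, mul_s_mul_s]

theorem len_inv (w : Perm (Fin n)) : len w⁻¹ = len w := by
  rw [len_eq_card_inversions, len_eq_card_inversions]
  refine Finset.card_bij (fun p _ => (w⁻¹ p.2, w⁻¹ p.1)) ?_ ?_ ?_
  · rintro ⟨p, q⟩ h
    rw [mem_inversions] at h ⊢
    simpa using h.symm
  · rintro ⟨p, q⟩ _ ⟨p', q'⟩ _ h
    simpa [and_comm] using h
  · rintro ⟨p, q⟩ h
    rw [mem_inversions] at h
    exact ⟨(w q, w p), mem_inversions.2 (by simpa using h.symm), by simp⟩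

theorem len_s_mul {w : Perm (Fin n)} {i : Fin (n - 1)} (h : i ∉ descentSet w⁻¹) :
    len (s i * w) = len w + 1 := by
  rw [← len_inv, mul_inv_rev, s_inv, len_mul_s h, len_inv]

theorem len_s_mul_add_one {w : Perm (Fin n)} {i : Fin (n - 1)} (h : i ∈ descentSet w⁻¹) :
    len (s i * w) + 1 = len w := by
  rw [← len_inv, mul_inv_rev, s_inv, len_mul_s_add_one h, len_inv]

theorem isReducedWord_cons {w : Perm (Fin n)} {i : Fin (n - 1)} {l : List (Fin (n - 1))} :
    IsReducedWord w (i :: l) ↔ i ∈ descentSet w⁻¹ ∧ IsReducedWord (s i * w) l := by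
  constructor
  · intro h
    have h1 : (l.map s).prod = s i * w := by
      rw [← h.1, List.map_cons, List.prod_cons, s_mul_s_mul]
    have h2 := (isReducedWord_iff.1 h).2
    have h3 : len (s i * w) ≤ l.length := (isReducedWord_reducedWord (s i * w)).2 l h1
    rw [List.length_cons] at h2
    have h4 : i ∈ descentSet w⁻¹ := by
      by_contra h'
      rw [len_s_mul h'] at h3
      omega
    have := len_s_mul_add_one h4
    exact ⟨h4, isReducedWord_iff.2 ⟨h1, by omega⟩⟩
  · rintro ⟨h1, h2⟩
    have := len_s_mul_add_one h1
    rw [isReducedWord_iff] at h2 ⊢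
    refine ⟨by rw [List.map_cons, List.prod_cons, h2.1, s_mul_s_mul], ?_⟩
    rw [List.length_cons, h2.2, this]

theorem IsReducedWord.append_singleton {w : Perm (Fin n)} {i : Fin (n - 1)}
    {l : List (Fin (n - 1))} (h : IsReducedWord w l) (hi' : i ∉ descentSet w) :
    IsReducedWord (w * s i) (l ++ [i]) := by
  rw [isReducedWord_iff] at h ⊢
  rw [len_mul_s hi']
  simp [h.1, h.2]

theorem len_eq_zero {w : Perm (Fin n)} (h : len w = 0) : w = 1 := by
  have := (isReducedWord_reducedWord w).1
  rw [List.eq_nil_of_length_eq_zero h] at this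
  simpa using this.symm

theorem reducedWord_one : reducedWord (1 : Perm (Fin n)) = [] :=
  List.eq_nil_of_length_eq_zero
    (Nat.le_zero.1 ((isReducedWord_reducedWord (1 : Perm (Fin n))).2 [] rfl))

/-- Induction on permutations along the left weak order. -/
theorem perm_induction {p : Perm (Fin n) → Prop} (h1 : p 1)
    (hs : ∀ i w, i ∉ descentSet w⁻¹ → p w → p (s i * w)) (w : Perm (Fin n)) : p w := by
  induction hk : len w generalizing w with
  | zero => rw [len_eq_zero hk]; exact h1
  | succ k ih =>
    have : descentSet w⁻¹ ≠ ∅ := by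
      intro h
      have h' := eq_one_of_descentSet_eq_empty h
      rw [inv_eq_one] at h'
      rw [h', len, reducedWord_one] at hk
      simp at hk
    obtain ⟨i, hi'⟩ := Finset.nonempty_iff_ne_empty.2 this
    have h2 := len_s_mul_add_one hi'
    rw [← s_mul_s_mul i w]
    exact hs i _ (fun h' => mem_descentSet_inv_s_mul.1 h' hi') (ih _ (by omega))

/-- Multiplying on the left by an ascent only adds right descents. -/
theorem descentSet_subset_s_mul {w : Perm (Fin n)} {i : Fin (n - 1)} (h : i ∉ descentSet w⁻¹) :
    descentSet w ⊆ descentSet (s i * w) := by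
  intro j hj
  rw [mem_descentSet] at hj ⊢
  refine s_lt_s hj ?_
  rintro ⟨h1, h2⟩
  have := lt_of_notMem_descentSet h
  rw [← h1, ← h2] at this
  simp only [← Perm.mul_apply, inv_mul_cancel, Perm.one_apply] at this
  exact lt_asymm this (lo_lt_hi j)

/-! ### Products along reduced words -/

/-- The family `f` satisfies the braid relations of type `A`. -/
structure IsBraided {M : Type*} [Monoid M] (f : Fin (n - 1) → M) : Prop where
  braid : ∀ i j : Fin (n - 1), (i : ℕ) + 1 = j → f i * f j * f i = f j * f i * f j
  comm : ∀ i j : Fin (n - 1), (i : ℕ) + 1 < j → f i * f j = f j * f i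

/-- The product of the family `f` along a reduced word of `w`. -/
def wordProd {M : Type*} [Monoid M] (f : Fin (n - 1) → M) (w : Perm (Fin n)) : M :=
  ((reducedWord w).map f).prod

theorem descent_of_comm {v : Perm (Fin n)} {i j : Fin (n - 1)}
    (hij : (i : ℕ) + 1 < j ∨ (j : ℕ) + 1 < i) (hj : j ∈ descentSet v) :
    j ∈ descentSet (v * s i) := by
  have e1 : s i (lo j) = lo j := by
    apply s_apply_of_ne <;> simp only [lo] <;> omega
  have e2 : s i (hi j) = hi j := by
    apply s_apply_of_ne <;> simp only [hi] <;> omega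
  rw [mem_descentSet] at hj ⊢
  simpa [e1, e2] using hj

theorem descent_of_braid {v : Perm (Fin n)} {i j : Fin (n - 1)} (hij : (i : ℕ) + 1 = j)
    (hi' : i ∈ descentSet v) (hj : j ∈ descentSet v) :
    j ∈ descentSet (v * s i) ∧ i ∈ descentSet (v * s i * s j) ∧
      i ∈ descentSet (v * s j) ∧ j ∈ descentSet (v * s j * s i) := by
  have hh : hi i = lo j := by simp [lo, hi, hij]
  have e1 : s i (lo j) = lo i := by rw [← hh, s_hi]
  have e2 : s i (hi j) = hi j := by
    apply s_apply_of_ne <;> simp only [hi] <;> omega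
  have e3 : s j (lo i) = lo i := by
    apply s_apply_of_ne <;> simp only [lo] <;> omega
  simp only [mem_descentSet, Perm.mul_apply, hh, e1, e2, e3, s_lo, s_hi] at *
  exact ⟨hj.trans hi', hj, hj.trans hi', hi'⟩

/-- Matsumoto's theorem for the symmetric group: a family satisfying the braid relations has the
same product along any two reduced words of a permutation. -/
theorem IsBraided.prod_eq {M : Type*} [Monoid M] {f : Fin (n - 1) → M} (hf : IsBraided f)
    {w : Perm (Fin n)} {l l' : List (Fin (n - 1))} (hl : IsReducedWord w l)
    (hl' : IsReducedWord w l') : (l.map f).prod = (l'.map f).prod := by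
  induction hk : l.length using Nat.strong_induction_on generalizing w l l' with
  | _ k ih =>
  have hlen : l.length = l'.length :=
    (isReducedWord_iff.1 hl).2.trans (isReducedWord_iff.1 hl').2.symm
  match l, l', hlen with
  | [], [], _ => rfl
  | i :: a, j :: b, hlen =>
    have hk' : a.length < k := by simp only [List.length_cons] at hk; omega
    simp only [List.map_cons, List.prod_cons]
    -- For two different first letters `i < j`, both words are compared with words that begin with
    -- the two sides of the braid relation between `i` and `j`.
    have main : ∀ (i j : Fin (n - 1)) (a b : List (Fin (n - 1))), a.length < k → b.length < k →
        IsReducedWord w (i :: a) → IsReducedWord w (j :: b) → (i : ℕ) < j →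
        f i * (a.map f).prod = f j * (b.map f).prod := by
      intro i j a b ha hb hia hjb hij
      rw [isReducedWord_cons] at hia hjb
      rcases Nat.lt_or_ge ((i : ℕ) + 1) j with h | h
      · have hc := isReducedWord_reducedWord (s j * (s i * w))
        have h1 : IsReducedWord (s i * w) (j :: reducedWord (s j * (s i * w))) :=
          isReducedWord_cons.2 ⟨by
            rw [mul_inv_rev, s_inv]; exact descent_of_comm (Or.inl h) hjb.1, hc⟩
        have hss : s i * s j = (s j * s i : Perm (Fin n)) := by
          apply Equiv.Perm.Disjoint.commute
          apply Equiv.Perm.disjoint_swap_swap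
          simp [lo, hi, Fin.ext_iff]
          omega
        have h2 : IsReducedWord (s j * w) (i :: reducedWord (s j * (s i * w))) :=
          isReducedWord_cons.2 ⟨by
            rw [mul_inv_rev, s_inv]; exact descent_of_comm (Or.inr h) hia.1, by
            rwa [← mul_assoc, hss, mul_assoc]⟩
        rw [ih _ ha hia.2 h1 rfl, ih _ hb hjb.2 h2 rfl]
        simp only [List.map_cons, List.prod_cons, ← mul_assoc, hf.comm i j h]
      · have h : (i : ℕ) + 1 = j := by omega
        obtain ⟨d1, d2, d3, d4⟩ := descent_of_braid h hia.1 hjb.1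
        have hc := isReducedWord_reducedWord (s i * (s j * (s i * w)))
        have h1 : IsReducedWord (s i * w) (j :: i :: reducedWord (s i * (s j * (s i * w)))) := by
          rw [isReducedWord_cons, isReducedWord_cons]
          simp only [mul_inv_rev, s_inv]
          exact ⟨d1, d2, hc⟩
        have hh : hi i = lo j := by simp [lo, hi, h]
        have hne : (lo i : Fin n) ≠ hi j := by simp [lo, hi, Fin.ext_iff]; omega
        have hsts : s i * (s j * s i) = (s j * (s i * s j) : Perm (Fin n)) := by
          have h3 := lo_ne_hi (n := n) i
          have h4 := lo_ne_hi (n := n) j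
          rw [hh] at h3
          have e1 := Equiv.swap_mul_swap_mul_swap h4.symm hne.symm
          have e2 := Equiv.swap_mul_swap_mul_swap h3 hne
          rw [Equiv.swap_comm (lo j) (lo i), Equiv.swap_comm (hi j) (lo j)] at e1
          rw [Equiv.swap_comm (hi j) (lo i)] at e2
          unfold s
          rw [hh, ← mul_assoc, ← mul_assoc, e1, e2]
        have h2 : IsReducedWord (s j * w) (i :: j :: reducedWord (s i * (s j * (s i * w)))) := by
          rw [isReducedWord_cons, isReducedWord_cons]
          simp only [mul_inv_rev, s_inv]
          refine ⟨d3, d4, ?_⟩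
          have : s j * (s i * (s j * w)) = s i * (s j * (s i * w)) := by
            simp only [← mul_assoc] at hsts ⊢
            rw [hsts]
          rwa [this]
        rw [ih _ ha hia.2 h1 rfl, ih _ hb hjb.2 h2 rfl]
        simp only [List.map_cons, List.prod_cons, ← mul_assoc, hf.braid i j h]
    have hk'' : b.length < k := by simp only [List.length_cons] at hlen; omega
    rcases lt_trichotomy (i : ℕ) j with h | h | h
    · exact main i j a b hk' hk'' hl hl' h
    · obtain rfl := Fin.ext h
      rw [ih _ hk' (isReducedWord_cons.1 hl).2 (isReducedWord_cons.1 hl').2 rfl]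
    · exact (main j i b a hk'' hk' hl' hl h).symm

section wordProd

variable {M : Type*} [Monoid M] {f : Fin (n - 1) → M}

theorem wordProd_one : wordProd f (1 : Perm (Fin n)) = 1 := by
  simp [wordProd, reducedWord_one]

theorem IsBraided.mul_wordProd (hf : IsBraided f) {w : Perm (Fin n)} {i : Fin (n - 1)}
    (h : i ∉ descentSet w⁻¹) : f i * wordProd f w = wordProd f (s i * w) := by
  have : IsReducedWord (s i * w) (i :: reducedWord w) := isReducedWord_cons.2
    ⟨mem_descentSet_inv_s_mul.2 h, by rw [s_mul_s_mul]; exact isReducedWord_reducedWord w⟩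
  have := hf.prod_eq this (isReducedWord_reducedWord _)
  rw [List.map_cons, List.prod_cons] at this
  exact this

theorem IsBraided.wordProd_mul (hf : IsBraided f) {w : Perm (Fin n)} {i : Fin (n - 1)}
    (h : i ∉ descentSet w) : wordProd f w * f i = wordProd f (w * s i) := by
  have := hf.prod_eq ((isReducedWord_reducedWord w).append_singleton h)
    (isReducedWord_reducedWord _)
  rw [List.map_append, List.prod_append, List.map_cons, List.map_nil, List.prod_singleton] at this
  exact this

theorem IsBraided.mul_wordProd_s_mul (hf : IsBraided f) {w : Perm (Fin n)} {i : Fin (n - 1)}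
    (h : i ∈ descentSet w⁻¹) : f i * wordProd f (s i * w) = wordProd f w := by
  rw [hf.mul_wordProd fun h' => mem_descentSet_inv_s_mul.1 h' h, s_mul_s_mul]

theorem IsBraided.wordProd_mul_s_mul (hf : IsBraided f) {w : Perm (Fin n)} {i : Fin (n - 1)}
    (h : i ∈ descentSet w) : wordProd f (w * s i) * f i = wordProd f w := by
  rw [hf.wordProd_mul fun h' => mem_descentSet_mul_s.1 h' h, mul_s_mul_s]

end wordProd

/-! ### The longest element of a parabolic subgroup -/

/-- An element of the parabolic subgroup attached to `I` preserves every initial segment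
`{1, …, i}` with `i ∉ I`. -/
theorem apply_le_of_mem_parabolic {I : Finset (Fin (n - 1))} {u : Perm (Fin n)}
    (hu : u ∈ parabolic I) {i : Fin (n - 1)} (hi' : i ∉ I) (x : Fin n) :
    u x ≤ lo i ↔ x ≤ lo i := by
  unfold parabolic at hu
  induction hu using Subgroup.closure_induction generalizing x with
  | mem g hg =>
    obtain ⟨j, hj, rfl⟩ := hg
    have hne : (i : ℕ) ≠ j := fun e => hi' (Fin.ext e ▸ hj)
    rw [Fin.le_def, Fin.le_def, s_val]
    simp only [lo]
    split_ifs <;> omega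
  | one => rfl
  | mul a b _ _ ha hb => rw [Perm.mul_apply, ha, hb]
  | inv a _ ha => rw [← ha, ← Perm.mul_apply, mul_inv_cancel, Perm.one_apply]

theorem descentSet_subset_of_mem_parabolic {I : Finset (Fin (n - 1))} {u : Perm (Fin n)}
    (hu : u ∈ parabolic I) : descentSet u ⊆ I := by
  intro i hi'
  by_contra h
  have h1 := (apply_le_of_mem_parabolic hu h (lo i)).2 le_rfl
  have h2 := mt (apply_le_of_mem_parabolic hu h (hi i)).1 (not_le.2 (lo_lt_hi i))
  exact absurd (mem_descentSet.1 hi') (not_lt.2 (h1.trans (not_le.1 h2).le))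

theorem s_mem_parabolic {I : Finset (Fin (n - 1))} {i : Fin (n - 1)} (h : i ∈ I) :
    s i ∈ parabolic I := Subgroup.subset_closure ⟨i, h, rfl⟩

theorem w₀_mem_parabolic (I : Finset (Fin (n - 1))) : w₀ I ∈ parabolic I :=
  (Classical.choose_spec (exists_longest I)).1

theorem descentSet_w₀ (I : Finset (Fin (n - 1))) : descentSet (w₀ I) = I := by
  refine (descentSet_subset_of_mem_parabolic (w₀_mem_parabolic I)).antisymm fun i hi' => ?_
  by_contra h
  have h1 := (Classical.choose_spec (exists_longest I)).2 _
    (mul_mem (w₀_mem_parabolic I) (s_mem_parabolic hi'))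
  have h2 := len_mul_s h
  change len (w₀ I * s i) ≤ len (w₀ I) at h1
  omega

theorem descentSet_w₀_inv (I : Finset (Fin (n - 1))) : descentSet (w₀ I)⁻¹ = I := by
  refine (descentSet_subset_of_mem_parabolic (inv_mem (w₀_mem_parabolic I))).antisymm
    fun i hi' => ?_
  by_contra h
  have h1 := (Classical.choose_spec (exists_longest I)).2 _
    (mul_mem (s_mem_parabolic hi') (w₀_mem_parabolic I))
  have h2 := len_s_mul h
  change len (s i * w₀ I) ≤ len (w₀ I) at h1
  omega

theorem IsReducedWord.mem_of_mem_parabolic {I : Finset (Fin (n - 1))} {u : Perm (Fin n)}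
    {l : List (Fin (n - 1))} (hl : IsReducedWord u l) (hu : u ∈ parabolic I) : ∀ i ∈ l, i ∈ I := by
  induction l generalizing u with
  | nil => simp
  | cons j l ih =>
    rw [isReducedWord_cons] at hl
    have hj := descentSet_subset_of_mem_parabolic (inv_mem hu) hl.1
    intro i hi'
    rcases List.mem_cons.1 hi' with rfl | h
    · exact hj
    · exact ih hl.2 (mul_mem (s_mem_parabolic hj) hu) i h

theorem mem_of_mem_reducedWord_w₀ {I : Finset (Fin (n - 1))} {i : Fin (n - 1)}
    (h : i ∈ reducedWord (w₀ I)) : i ∈ I :=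
  (isReducedWord_reducedWord _).mem_of_mem_parabolic (w₀_mem_parabolic I) i h

end Perm

/-! ### Unitriangular families -/

section Triangular

variable {R M ι κ : Type*} [CommRing R] [AddCommGroup M] [Module R M]

/-- A family that is unitriangular with respect to a basis, along an injective map of index sets,
is linearly independent. -/
theorem linearIndependent_of_triangular (B : Module.Basis κ R M) (key : κ → ℕ) {L : ι → κ}
    (hL : Function.Injective L) {f : ι → M}
    (hf : ∀ i, f i - B (L i) ∈ Submodule.span R (B '' {b | key b < key (L i)})) :
    LinearIndependent R f := by
  classical
  have hcoef : ∀ i k, key (L i) ≤ key k → B.repr (f i) k = if L i = k then 1 else 0 := by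
    intro i k hk
    have h := B.mem_span_image.1 (hf i)
    have h0 : B.repr (f i - B (L i)) k = 0 := by
      by_contra h'
      have : k ∈ {b | key b < key (L i)} := h (by simpa using h')
      exact absurd this (not_lt.2 hk)
    rw [map_sub, Finsupp.sub_apply, sub_eq_zero, B.repr_self, Finsupp.single_apply] at h0
    exact h0
  rw [linearIndependent_iff']
  intro t g hg
  by_contra! hne
  obtain ⟨i, hi, hgi⟩ := hne
  -- An index with nonzero coefficient whose leading term is the highest.
  obtain ⟨j, hj, hmax⟩ := (t.filter fun i => g i ≠ 0).exists_max_image (fun i => key (L i))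
    ⟨i, Finset.mem_filter.2 ⟨hi, hgi⟩⟩
  rw [Finset.mem_filter] at hj
  have h0 := congrArg (fun x => B.repr x (L j)) hg
  simp only [map_sum, map_smul, Finsupp.coe_finsetSum, Finset.sum_apply, Finsupp.smul_apply,
    smul_eq_mul, map_zero, Finsupp.zero_apply] at h0
  rw [Finset.sum_eq_single j, hcoef j _ le_rfl, if_pos rfl, mul_one] at h0
  · exact hj.2 h0
  · intro k hk hkj
    by_cases hgk : g k = 0
    · rw [hgk, zero_mul]
    · rw [hcoef k _ (hmax k (Finset.mem_filter.2 ⟨hk, hgk⟩)), if_neg fun e => hkj (hL e), mul_zero]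
  · exact fun h => absurd hj.1 h

/-- A family that is unitriangular with respect to a basis, along a surjective map of index sets,
spans. -/
theorem span_eq_top_of_triangular (B : Module.Basis κ R M) (key : κ → ℕ) {L : ι → κ}
    (hL : Function.Surjective L) {f : ι → M}
    (hf : ∀ i, f i - B (L i) ∈ Submodule.span R (B '' {b | key b < key (L i)})) :
    Submodule.span R (Set.range f) = ⊤ := by
  have key' : ∀ N k, key k = N → B k ∈ Submodule.span R (Set.range f) := by
    intro N
    induction N using Nat.strong_induction_on with
    | _ N ih =>
      intro k hk
      obtain ⟨i, rfl⟩ := hL k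
      have h1 : Submodule.span R (B '' {b | key b < key (L i)}) ≤
          Submodule.span R (Set.range f) := by
        rw [Submodule.span_le]
        rintro _ ⟨b, hb, rfl⟩
        exact ih _ (hk ▸ hb) b rfl
      have h2 := sub_mem (Submodule.subset_span (Set.mem_range_self i)) (h1 (hf i))
      rwa [sub_sub_cancel] at h2
  rw [eq_top_iff, ← B.span_eq, Submodule.span_le]
  rintro _ ⟨k, rfl⟩
  exact key' _ k rfl

end Triangular

/-! ### The `0`-Hecke algebra: multiplication rules and characters -/

section Hecke

variable {R : Type*} [CommRing R] {n : ℕ}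

theorem T_mul_T (i : Fin (n - 1)) : T R i * T R i = -T R i := by
  have := RingQuot.mkAlgHom_rel R (HeckeRel.quad (R := R) i)
  rw [map_mul, map_neg] at this
  exact this

theorem isBraided_T : IsBraided (T R : Fin (n - 1) → ZeroHecke R n) where
  braid i j h := by
    have := RingQuot.mkAlgHom_rel R (HeckeRel.braid (R := R) i j h)
    simp only [map_mul] at this
    exact this
  comm i j h := by
    have := RingQuot.mkAlgHom_rel R (HeckeRel.comm (R := R) i j h)
    simp only [map_mul] at this
    exact this

theorem isBraided_T' : IsBraided (T' R : Fin (n - 1) → ZeroHecke R n) where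
  braid i j h := by
    have h1 := (isBraided_T (R := R)).braid i j h
    have h2 := T_mul_T (R := R) i
    have h3 := T_mul_T (R := R) j
    simp only [T', mul_add, add_mul, one_mul, mul_one, h1, h2, h3]
    abel
  comm i j h := by
    have h1 := (isBraided_T (R := R)).comm i j h
    simp only [T', mul_add, add_mul, one_mul, mul_one, h1]
    abel

theorem T_mul_T' (i : Fin (n - 1)) : T R i * T' R i = 0 := by
  rw [T', mul_add, T_mul_T, mul_one, neg_add_cancel]

theorem Tw_one : Tw R (1 : Perm (Fin n)) = 1 := wordProd_one

theorem T_mul_Tw {w : Perm (Fin n)} {i : Fin (n - 1)} (h : i ∉ descentSet w⁻¹) :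
    T R i * Tw R w = Tw R (s i * w) := isBraided_T.mul_wordProd h

theorem T_mul_Tw_of_mem {w : Perm (Fin n)} {i : Fin (n - 1)} (h : i ∈ descentSet w⁻¹) :
    T R i * Tw R w = -Tw R w := by
  have : T R i * Tw R (s i * w) = Tw R w := isBraided_T.mul_wordProd_s_mul h
  rw [← this, ← mul_assoc, T_mul_T, neg_mul]

theorem Tw_mul_T {w : Perm (Fin n)} {i : Fin (n - 1)} (h : i ∉ descentSet w) :
    Tw R w * T R i = Tw R (w * s i) := isBraided_T.wordProd_mul h

theorem Tw_mul_s_mul_T {w : Perm (Fin n)} {i : Fin (n - 1)} (h : i ∈ descentSet w) :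
    Tw R (w * s i) * T R i = Tw R w := isBraided_T.wordProd_mul_s_mul h

theorem Tw_mul_T_of_mem {w : Perm (Fin n)} {i : Fin (n - 1)} (h : i ∈ descentSet w) :
    Tw R w * T R i = -Tw R w := by
  rw [← Tw_mul_s_mul_T h, mul_assoc, T_mul_T, mul_neg]

theorem T_mul_Tw' {w : Perm (Fin n)} {i : Fin (n - 1)} (h : i ∈ descentSet w⁻¹) :
    T R i * Tw' R w = 0 := by
  have : T' R i * Tw' R (s i * w) = Tw' R w := isBraided_T'.mul_wordProd_s_mul h
  rw [← this, ← mul_assoc, T_mul_T', zero_mul]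

/-- Up to a sign, `T_w` is fixed under right multiplication by `T_{w₀(I)}` when `I` consists of
descents of `w`. -/
theorem Tw_mul_Tw_w₀ {w : Perm (Fin n)} {I : Finset (Fin (n - 1))} (h : I ⊆ descentSet w) :
    Tw R w * Tw R (w₀ I) = (-1) ^ len (w₀ I) * Tw R w := by
  have key : ∀ l : List (Fin (n - 1)), (∀ i ∈ l, i ∈ descentSet w) →
      Tw R w * (l.map (T R)).prod = (-1) ^ l.length * Tw R w := by
    intro l hl
    induction l with
    | nil => simp
    | cons i l ih =>
      rw [List.map_cons, List.prod_cons, ← mul_assoc, Tw_mul_T_of_mem (hl i List.mem_cons_self),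
        neg_mul, ih fun j hj => hl j (List.mem_cons_of_mem _ hj), List.length_cons, pow_succ]
      simp
  exact key _ fun i hi' => h (mem_of_mem_reducedWord_w₀ hi')

/-- Induction principle: `H_n(0)` is generated by the `T_i` as an `R`-algebra. -/
theorem hecke_induction {p : ZeroHecke R n → Prop} (algebraMap : ∀ r, p (algebraMap R _ r))
    (T : ∀ i, p (T R i)) (mul : ∀ a b, p a → p b → p (a * b)) (add : ∀ a b, p a → p b → p (a + b))
    (h : ZeroHecke R n) : p h := by
  obtain ⟨x, rfl⟩ := RingQuot.mkAlgHom_surjective R (HeckeRel R n) h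
  induction x using FreeAlgebra.induction with
  | grade0 r => rw [AlgHom.commutes]; exact algebraMap r
  | grade1 i => exact T i
  | mul a b ha hb => rw [map_mul]; exact mul _ _ ha hb
  | add a b ha hb => rw [map_add]; exact add _ _ ha hb

/-- The elements `T_w` span `H_n(0)`. -/
theorem span_Tw : Submodule.span R (Set.range (Tw R : Perm (Fin n) → ZeroHecke R n)) = ⊤ := by
  have key : ∀ h x : ZeroHecke R n, x ∈ Submodule.span R (Set.range (Tw R)) →
      h * x ∈ Submodule.span R (Set.range (Tw R)) := by
    intro h
    induction h using hecke_induction with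
    | algebraMap r => intro x hx; rw [← Algebra.smul_def]; exact Submodule.smul_mem _ _ hx
    | T i =>
      intro x hx
      induction hx using Submodule.span_induction with
      | mem y hy =>
        obtain ⟨w, rfl⟩ := hy
        by_cases h : i ∈ descentSet w⁻¹
        · rw [T_mul_Tw_of_mem h]
          exact neg_mem (Submodule.subset_span ⟨w, rfl⟩)
        · rw [T_mul_Tw h]
          exact Submodule.subset_span ⟨_, rfl⟩
      | zero => rw [mul_zero]; exact zero_mem _
      | add y z _ _ hy hz => rw [mul_add]; exact add_mem hy hz
      | smul r y _ hy => rw [mul_smul_comm]; exact Submodule.smul_mem _ _ hy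
    | mul a b ha hb => intro x hx; rw [mul_assoc]; exact ha _ (hb _ hx)
    | add a b ha hb => intro x hx; rw [add_mul]; exact add_mem (ha _ hx) (hb _ hx)
  rw [eq_top_iff]
  intro h _
  rw [← mul_one h]
  exact key h 1 (Tw_one (R := R) (n := n) ▸ Submodule.subset_span ⟨1, rfl⟩)

/-- The product `T_w T'_{w₀(Dᶜ)}`, where `D` is the descent set of `w`, is `T_w` plus a combination
of elements `T_v` with `v` longer than `w`. -/
theorem Tw_mul_Tw'_sub_mem (w : Perm (Fin n)) :
    Tw R w * Tw' R (w₀ (descentSet w)ᶜ) - Tw R w ∈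
      Submodule.span R (Tw R '' {v | len w < len v}) := by
  have hT : ∀ (x : ZeroHecke R n) (i : Fin (n - 1)),
      x ∈ Submodule.span R (Tw R '' {v | len w < len v}) →
      x * T R i ∈ Submodule.span R (Tw R '' {v | len w < len v}) := by
    intro x i hx
    induction hx using Submodule.span_induction with
    | mem y hy =>
      obtain ⟨v, hv, rfl⟩ := hy
      by_cases h : i ∈ descentSet v
      · rw [Tw_mul_T_of_mem h]
        exact neg_mem (Submodule.subset_span ⟨v, hv, rfl⟩)
      · rw [Tw_mul_T h]
        refine Submodule.subset_span ⟨_, ?_, rfl⟩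
        rw [Set.mem_ofPred_eq, len_mul_s h]
        exact Nat.lt_succ_of_lt hv
    | zero => rw [zero_mul]; exact zero_mem _
    | add y z _ _ hy hz => rw [add_mul]; exact add_mem hy hz
    | smul r y _ hy => rw [smul_mul_assoc]; exact Submodule.smul_mem _ _ hy
  have key : ∀ l : List (Fin (n - 1)), (∀ i ∈ l, i ∉ descentSet w) →
      Tw R w * (l.map (T' R)).prod - Tw R w ∈ Submodule.span R (Tw R '' {v | len w < len v}) := by
    intro l hl
    induction l using List.reverseRecOn with
    | nil => simp
    | append_singleton l i ih =>
      have hi' : i ∉ descentSet w := hl i (by simp)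
      have h1 := ih fun j hj => hl j (List.mem_append_left _ hj)
      have h2 : Tw R w * T R i ∈ Submodule.span R (Tw R '' {v | len w < len v}) := by
        rw [Tw_mul_T hi']
        refine Submodule.subset_span ⟨_, ?_, rfl⟩
        rw [Set.mem_ofPred_eq, len_mul_s hi']
        exact Nat.lt_succ_self _
      have h3 := add_mem h1 (add_mem (hT _ i h1) h2)
      convert h3 using 1
      simp only [List.map_append, List.prod_append, List.map_cons, List.map_nil,
        List.prod_singleton, T', mul_add, mul_one, sub_mul, mul_assoc]
      abel
  exact key _ fun i hi' => Finset.mem_compl.1 (mem_of_mem_reducedWord_w₀ hi')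

/-- The character of `H_n(0)` that sends `T_i` to `-1` for `i ∈ A` and to `0` for `i ∉ A`. -/
def character (R : Type*) [CommRing R] {n : ℕ} (A : Finset (Fin (n - 1))) :
    ZeroHecke R n →ₐ[R] R :=
  RingQuot.liftAlgHom R ⟨FreeAlgebra.lift R fun i => if i ∈ A then -1 else 0, by
    intro x y h
    induction h with
    | quad i => simp only [map_mul, map_neg, FreeAlgebra.lift_ι_apply]; split_ifs <;> simp
    | braid i j hij => simp only [map_mul, FreeAlgebra.lift_ι_apply]; ring_nf; split_ifs <;> simp
    | comm i j hij => simp only [map_mul, FreeAlgebra.lift_ι_apply]; ring⟩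

theorem character_T (A : Finset (Fin (n - 1))) (i : Fin (n - 1)) :
    character R A (T R i) = if i ∈ A then -1 else 0 := by
  unfold character T
  exact (RingQuot.liftAlgHom_mkAlgHom_apply R _ _ _).trans (FreeAlgebra.lift_ι_apply _ _)

theorem character_Tw_w₀_eq_zero {A I : Finset (Fin (n - 1))} (h : ¬ I ⊆ A) :
    character R A (Tw R (w₀ I)) = 0 := by
  obtain ⟨i, hi', hiA⟩ := Finset.not_subset.1 h
  have h1 : i ∈ descentSet (w₀ I)⁻¹ := by rwa [descentSet_w₀_inv]
  have h2 := congrArg (character R A) (T_mul_Tw_of_mem (R := R) h1)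
  rwa [map_mul, character_T, if_neg hiA, zero_mul, map_neg, eq_comm, neg_eq_zero] at h2

theorem character_Tw'_w₀_eq_zero {A I : Finset (Fin (n - 1))} (h : ¬ Disjoint I A) :
    character R A (Tw' R (w₀ I)) = 0 := by
  obtain ⟨i, hi', hiA⟩ := Finset.not_disjoint_iff.1 h
  have h1 : i ∈ descentSet (w₀ I)⁻¹ := by rwa [descentSet_w₀_inv]
  have h2 := congrArg (character R A) (T_mul_Tw' (R := R) h1)
  rwa [map_mul, character_T, if_pos hiA, neg_one_mul, map_zero, neg_eq_zero] at h2

/-- The character attached to `A` vanishes on Norton's generator attached to `I`, unless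
`A = I`. -/
theorem character_generator_eq_zero {A I : Finset (Fin (n - 1))} (h : A ≠ I) :
    character R A (Tw R (w₀ I) * Tw' R (w₀ Iᶜ)) = 0 := by
  rw [map_mul]
  by_cases h1 : I ⊆ A
  · rw [character_Tw'_w₀_eq_zero, mul_zero]
    intro h2
    exact h (Finset.Subset.antisymm (disjoint_compl_left_iff.1 h2) h1)
  · rw [character_Tw_w₀_eq_zero h1, zero_mul]

/-- Modulo elements `T_v` with `v` longer than `w`, left multiplication by `h` scales `T_w` by the
value at `h` of the character attached to the left descents of `w`. The bound `k` in place of the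
length of `w` makes the statement multiplicative in `h`. -/
theorem mul_Tw_sub_mem (h : ZeroHecke R n) (k : ℕ) (w : Perm (Fin n)) (hw : k ≤ len w) :
    h * Tw R w - character R (descentSet w⁻¹) h • Tw R w ∈
      Submodule.span R (Tw R '' {v | k < len v}) := by
  have hmono : ∀ w : Perm (Fin n), k < len w →
      Tw R w ∈ Submodule.span R (Tw R '' {v | k < len v}) :=
    fun w hw => Submodule.subset_span ⟨w, hw, rfl⟩
  induction h using hecke_induction generalizing k w with
  | algebraMap r =>
    rw [AlgHom.commutes, ← Algebra.smul_def]
    simp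
  | T i =>
    rw [character_T]
    split_ifs with hi'
    · rw [T_mul_Tw_of_mem hi']; simp
    · rw [T_mul_Tw hi', zero_smul, sub_zero]
      exact hmono _ (by rw [len_s_mul hi']; omega)
  | mul a b ha hb =>
    have hstep : ∀ x ∈ Submodule.span R (Tw R '' {v : Perm (Fin n) | k < len v}),
        a * x ∈ Submodule.span R (Tw R '' {v : Perm (Fin n) | k < len v}) := by
      intro x hx
      induction hx using Submodule.span_induction with
      | mem y hy =>
        obtain ⟨v, hv, rfl⟩ := hy
        rw [← sub_add_cancel (a * Tw R v) (character R (descentSet v⁻¹) a • Tw R v)]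
        exact add_mem (ha k v (le_of_lt hv) hmono) (Submodule.smul_mem _ _ (hmono v hv))
      | zero => rw [mul_zero]; exact zero_mem _
      | add y z _ _ hy hz => rw [mul_add]; exact add_mem hy hz
      | smul r y _ hy => rw [mul_smul_comm]; exact Submodule.smul_mem _ _ hy
    have h1 := hstep _ (hb k w hw hmono)
    have h2 := Submodule.smul_mem _ (character R (descentSet w⁻¹) b) (ha k w hw hmono)
    convert add_mem h1 h2 using 1
    rw [map_mul, mul_sub, mul_smul_comm, smul_sub, smul_smul, mul_assoc, mul_comm]
    abel
  | add a b ha hb =>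
    convert add_mem (ha k w hw hmono) (hb k w hw hmono) using 1
    rw [map_add, add_mul, add_smul]
    abel

/-- An idempotent of `H_n(0)` that is killed by all characters vanishes: the characters describe
the diagonal of its triangular left multiplication matrix. -/
theorem idempotent_eq_zero {e : ZeroHecke R n} (he : e * e = e)
    (h : ∀ A, character R A e = 0) : e = 0 := by
  have key : ∀ k : ℕ, e ∈ Submodule.span R (Tw R '' {v : Perm (Fin n) | k ≤ len v}) := by
    intro k
    induction k with
    | zero =>
      simp only [Nat.zero_le, Set.ofPred_true, Set.image_univ, span_Tw]
      trivial
    | succ k ih =>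
      have : ∀ x ∈ Submodule.span R (Tw R '' {v : Perm (Fin n) | k ≤ len v}),
          e * x ∈ Submodule.span R (Tw R '' {v : Perm (Fin n) | k + 1 ≤ len v}) := by
        intro x hx
        induction hx using Submodule.span_induction with
        | mem y hy =>
          obtain ⟨v, hv, rfl⟩ := hy
          have := mul_Tw_sub_mem e k v hv
          rwa [h, zero_smul, sub_zero] at this
        | zero => rw [mul_zero]; exact zero_mem _
        | add y z _ _ hy hz => rw [mul_add]; exact add_mem hy hz
        | smul r y _ hy => rw [mul_smul_comm]; exact Submodule.smul_mem _ _ hy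
      rw [← he]
      exact this e ih
  -- No permutation is longer than the longest one, so `e` lies in the span of the empty set.
  obtain ⟨w, hw⟩ := Finite.exists_max (len : Perm (Fin n) → ℕ)
  have h1 := key (len w + 1)
  have h2 : {v : Perm (Fin n) | len w + 1 ≤ len v} = ∅ := by
    ext v
    simpa using hw v
  rw [h2] at h1
  simpa using h1

end Hecke

/-! ### Modules with a basis indexed by permutations and graded by descent sets -/

section Descent

variable {R : Type*} [CommRing R] {n : ℕ}

variable {M M' : Type*} [AddCommGroup M] [Module (ZeroHecke R n) M]
  [AddCommGroup M'] [Module (ZeroHecke R n) M']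

/-- A descent `i ∉ I` of `w` makes `T_w` end in `T_i`, which annihilates `m_I`. -/
theorem Tw_smul_eq_zero {m : Finset (Fin (n - 1)) → M}
    (hm : ∀ I i, i ∉ I → T R i • m I = 0) {I : Finset (Fin (n - 1))} {w : Perm (Fin n)}
    (h : ¬ descentSet w ⊆ I) : Tw R w • m I = 0 := by
  obtain ⟨i, hi', hiI⟩ := Finset.not_subset.1 h
  rw [← Tw_mul_s_mul_T hi', mul_smul, hm I i hiI, smul_zero]

variable [Module R M] [Module R M']

/-- The `H_n(0)`-module `M` has the `R`-basis `b_w = T_w m_{D(w)}`, where each vector `m_I` is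
annihilated by all `T_i` with `i ∉ I`. These conditions determine the action of `H_n(0)` on the
basis, hence the module. -/
structure IsDescentBasis (m : Finset (Fin (n - 1)) → M) (b : Module.Basis (Perm (Fin n)) R M) :
    Prop where
  T_smul_eq_zero : ∀ I i, i ∉ I → T R i • m I = 0
  apply_eq : ∀ w, b w = Tw R w • m (descentSet w)

namespace IsDescentBasis

variable {m : Finset (Fin (n - 1)) → M} {b : Module.Basis (Perm (Fin n)) R M}
  {m' : Finset (Fin (n - 1)) → M'} {b' : Module.Basis (Perm (Fin n)) R M'}

theorem T_smul_of_mem (hb : IsDescentBasis m b) {w : Perm (Fin n)} {i : Fin (n - 1)}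
    (h : i ∈ descentSet w⁻¹) : T R i • b w = -b w := by
  rw [hb.apply_eq, ← mul_smul, T_mul_Tw_of_mem h, neg_smul]

theorem T_smul_of_eq (hb : IsDescentBasis m b) {w : Perm (Fin n)} {i : Fin (n - 1)}
    (h : i ∉ descentSet w⁻¹) (hD : descentSet (s i * w) = descentSet w) :
    T R i • b w = b (s i * w) := by
  rw [hb.apply_eq, ← mul_smul, T_mul_Tw h, hb.apply_eq, hD]

theorem T_smul_of_ne (hb : IsDescentBasis m b) {w : Perm (Fin n)} {i : Fin (n - 1)}
    (h : i ∉ descentSet w⁻¹) (hD : descentSet (s i * w) ≠ descentSet w) :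
    T R i • b w = 0 := by
  rw [hb.apply_eq, ← mul_smul, T_mul_Tw h]
  exact Tw_smul_eq_zero hb.T_smul_eq_zero
    fun h' => hD (h'.antisymm (descentSet_subset_s_mul h))

end IsDescentBasis

variable [IsScalarTower R (ZeroHecke R n) M] [IsScalarTower R (ZeroHecke R n) M']

/-- The `H_n(0)`-submodule carried by an `R`-submodule that is stable under all `T_i`. -/
def stableSubmodule (N : Submodule R M) (hN : ∀ i : Fin (n - 1), ∀ x ∈ N, T R i • x ∈ N) :
    Submodule (ZeroHecke R n) M where
  __ := N
  smul_mem' h x hx := by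
    induction h using hecke_induction generalizing x with
    | algebraMap r => rw [algebraMap_smul]; exact N.smul_mem r hx
    | T i => exact hN i x hx
    | mul a b ha hb => rw [mul_smul]; exact ha _ (hb _ hx)
    | add a b ha hb => rw [add_smul]; exact N.add_mem (ha _ hx) (hb _ hx)

namespace IsDescentBasis

variable {m : Finset (Fin (n - 1)) → M} {b : Module.Basis (Perm (Fin n)) R M}
  {m' : Finset (Fin (n - 1)) → M'} {b' : Module.Basis (Perm (Fin n)) R M'}

/-- Two modules with such a basis are isomorphic. -/
def equiv (hb : IsDescentBasis m b) (hb' : IsDescentBasis m' b') : M ≃ₗ[ZeroHecke R n] M' where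
  __ := b.equiv b' (Equiv.refl _)
  map_smul' := by
    have hT : ∀ (i : Fin (n - 1)) (x : M), b.equiv b' (Equiv.refl _) (T R i • x) =
        T R i • b.equiv b' (Equiv.refl _) x := by
      intro i x
      have : (b.equiv b' (Equiv.refl _)).toLinearMap ∘ₗ Algebra.lsmul R R M (T R i) =
          Algebra.lsmul R R M' (T R i) ∘ₗ (b.equiv b' (Equiv.refl _)).toLinearMap := by
        refine b.ext fun w => ?_
        simp only [LinearMap.comp_apply, Algebra.lsmul_coe, LinearEquiv.coe_coe,
          Module.Basis.equiv_apply, Equiv.refl_apply]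
        by_cases h : i ∈ descentSet w⁻¹
        · rw [hb.T_smul_of_mem h, hb'.T_smul_of_mem h, map_neg, Module.Basis.equiv_apply,
            Equiv.refl_apply]
        · by_cases hD : descentSet (s i * w) = descentSet w
          · rw [hb.T_smul_of_eq h hD, hb'.T_smul_of_eq h hD, Module.Basis.equiv_apply,
              Equiv.refl_apply]
          · rw [hb.T_smul_of_ne h hD, hb'.T_smul_of_ne h hD, map_zero]
      exact LinearMap.congr_fun this x
    intro h x
    change b.equiv b' (Equiv.refl _) (h • x) = h • b.equiv b' (Equiv.refl _) x
    induction h using hecke_induction generalizing x with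
    | algebraMap r => rw [algebraMap_smul, algebraMap_smul, map_smul]
    | T i => exact hT i x
    | mul a c ha hc => rw [mul_smul, mul_smul, ha, hc]
    | add a c ha hc => rw [add_smul, add_smul, map_add, ha, hc]

theorem equiv_apply (hb : IsDescentBasis m b) (hb' : IsDescentBasis m' b') (w : Perm (Fin n)) :
    hb.equiv hb' (b w) = b' w :=
  b.equiv_apply b' (i := w) (Equiv.refl _)

/-- The action of `H_n(0)` does not change the descent sets of the basis vectors involved. -/
theorem T_smul_mem (hb : IsDescentBasis m b) (A : Set (Finset (Fin (n - 1)))) (i : Fin (n - 1)) :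
    ∀ x ∈ Submodule.span R (b '' {w | descentSet w ∈ A}),
      T R i • x ∈ Submodule.span R (b '' {w | descentSet w ∈ A}) := by
  intro x hx
  induction hx using Submodule.span_induction with
  | mem y hy =>
    obtain ⟨w, hw, rfl⟩ := hy
    by_cases h : i ∈ descentSet w⁻¹
    · rw [hb.T_smul_of_mem h]
      exact neg_mem (Submodule.subset_span ⟨w, hw, rfl⟩)
    · by_cases hD : descentSet (s i * w) = descentSet w
      · rw [hb.T_smul_of_eq h hD]
        exact Submodule.subset_span ⟨_, by change descentSet (s i * w) ∈ A; rwa [hD], rfl⟩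
      · rw [hb.T_smul_of_ne h hD]
        exact zero_mem _
  | zero => rw [smul_zero]; exact zero_mem _
  | add y z _ _ hy hz => rw [smul_add]; exact add_mem hy hz
  | smul r y _ hy => rw [smul_comm]; exact Submodule.smul_mem _ _ hy

/-- The cyclic submodule generated by `T_{w₀(I)} m_I` is the `R`-span of the basis vectors `b_w`
with `D(w) = I`. -/
theorem mem_span_singleton_iff (hb : IsDescentBasis m b) (I : Finset (Fin (n - 1))) (x : M) :
    x ∈ Submodule.span (ZeroHecke R n) {Tw R (w₀ I) • m I} ↔
      x ∈ Submodule.span R (b '' {w | descentSet w = I}) := by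
  constructor
  · intro hx
    have hle : Submodule.span (ZeroHecke R n) {Tw R (w₀ I) • m I} ≤
        stableSubmodule _ (hb.T_smul_mem {I}) := by
      rw [Submodule.span_le, Set.singleton_subset_iff]
      refine Submodule.subset_span ⟨w₀ I, descentSet_w₀ I, ?_⟩
      rw [hb.apply_eq, descentSet_w₀]
    exact hle hx
  · intro hx
    have hle : Submodule.span R (b '' {w | descentSet w = I}) ≤
        (Submodule.span (ZeroHecke R n) {Tw R (w₀ I) • m I}).restrictScalars R := by
      rw [Submodule.span_le]
      rintro _ ⟨w, rfl, rfl⟩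
      change b w ∈ Submodule.span (ZeroHecke R n) _
      -- By `Tw_mul_Tw_w₀`, multiplying the generator by `T_w` gives `b_w` up to a sign.
      have h1 : b w = ((-1) ^ len (w₀ (descentSet w)) * Tw R w) •
          (Tw R (w₀ (descentSet w)) • m (descentSet w)) := by
        rw [← mul_smul, mul_assoc, Tw_mul_Tw_w₀ subset_rfl, ← mul_assoc, ← pow_add,
          Even.neg_one_pow ⟨_, rfl⟩, one_mul, hb.apply_eq]
      rw [h1]
      exact Submodule.smul_mem _ _ (Submodule.mem_span_singleton_self _)
    exact hle hx

/-- The cyclic submodules generated by the vectors `T_{w₀(I)} m_I` decompose the module. -/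
theorem isInternal (hb : IsDescentBasis m b) {κ : Type*} [DecidableEq κ]
    {c : κ → Finset (Fin (n - 1))} (hc : Function.Bijective c) :
    DirectSum.IsInternal fun α =>
      Submodule.span (ZeroHecke R n) {Tw R (w₀ (c α)) • m (c α)} := by
  rw [DirectSum.isInternal_submodule_iff_iSupIndep_and_iSup_eq_top]
  constructor
  · intro α
    rw [Submodule.disjoint_def]
    intro x hx hx'
    have hle : (⨆ β, ⨆ (_ : β ≠ α), Submodule.span (ZeroHecke R n) {Tw R (w₀ (c β)) • m (c β)}) ≤
        stableSubmodule _ (hb.T_smul_mem {c α}ᶜ) := by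
      refine iSup₂_le fun β hβ y hy => ?_
      refine Submodule.span_mono (Set.image_mono ?_) ((hb.mem_span_singleton_iff _ _).1 hy)
      intro w hw h
      have hw' : descentSet w = c β := hw
      exact hβ (hc.1 (hw'.symm.trans h))
    have h1 := b.mem_span_image.1 ((hb.mem_span_singleton_iff _ _).1 hx)
    have h2 := b.mem_span_image.1 (hle hx')
    rw [← b.repr.map_eq_zero_iff, ← Finsupp.support_eq_empty, Finset.eq_empty_iff_forall_notMem]
    intro w hw
    exact h2 hw (h1 hw)
  · rw [eq_top_iff]
    intro x _
    rw [← b.sum_repr x]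
    refine sum_mem fun w _ => Submodule.smul_of_tower_mem _ _ ?_
    obtain ⟨α, hα⟩ := hc.2 (descentSet w)
    refine Submodule.mem_iSup_of_mem α ((hb.mem_span_singleton_iff _ _).2 ?_)
    exact Submodule.subset_span ⟨w, hα.symm, rfl⟩

/-- The vectors `T_w m_I` with `D(w) = I` are a basis of the submodule generated by
`T_{w₀(I)} m_I`. -/
theorem exists_basis (hb : IsDescentBasis m b) (I : Finset (Fin (n - 1))) :
    ∃ B : Module.Basis {w : Perm (Fin n) // descentSet w = I} R
        (Submodule.span (ZeroHecke R n) {Tw R (w₀ I) • m I}),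
      ∀ w, (B w : M) = Tw R w.1 • m I := by
  have hmem : ∀ w : {w : Perm (Fin n) // descentSet w = I},
      b w.1 ∈ Submodule.span (ZeroHecke R n) {Tw R (w₀ I) • m I} := fun w =>
    (hb.mem_span_singleton_iff _ _).2 (Submodule.subset_span ⟨w.1, w.2, rfl⟩)
  have hli : LinearIndependent R fun w : {w : Perm (Fin n) // descentSet w = I} =>
      (⟨b w.1, hmem w⟩ : Submodule.span (ZeroHecke R n) {Tw R (w₀ I) • m I}) := by
    refine LinearIndependent.of_comp
      ((Submodule.span (ZeroHecke R n) {Tw R (w₀ I) • m I}).subtype.restrictScalars R) ?_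
    exact b.linearIndependent.comp Subtype.val Subtype.val_injective
  refine ⟨Module.Basis.mk hli ?_, fun w => ?_⟩
  · rintro ⟨x, hx⟩ -
    have h1 := (hb.mem_span_singleton_iff _ _).1 hx
    induction h1 using Submodule.span_induction with
    | mem y hy =>
      obtain ⟨w, hw, rfl⟩ := hy
      exact Submodule.subset_span ⟨⟨w, hw⟩, rfl⟩
    | zero => exact zero_mem _
    | add y z hy hz hy' hz' =>
      exact add_mem (hy' ((hb.mem_span_singleton_iff _ _).2 hy))
        (hz' ((hb.mem_span_singleton_iff _ _).2 hz))
    | smul r y hy hy' =>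
      exact Submodule.smul_mem _ r (hy' ((hb.mem_span_singleton_iff _ _).2 hy))
  · rw [Module.Basis.mk_apply]
    change b w.1 = _
    rw [hb.apply_eq, w.2]

theorem nonempty_equiv_span (hb : IsDescentBasis m b) (hb' : IsDescentBasis m' b')
    (I : Finset (Fin (n - 1))) :
    Nonempty (Submodule.span (ZeroHecke R n) {Tw R (w₀ I) • m I} ≃ₗ[ZeroHecke R n]
      Submodule.span (ZeroHecke R n) {Tw R (w₀ I) • m' I}) := by
  refine ⟨((hb.equiv hb').submoduleMap _).trans (LinearEquiv.ofEq _ _ ?_)⟩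
  have h1 := hb.apply_eq (w₀ I)
  have h2 := hb'.apply_eq (w₀ I)
  rw [descentSet_w₀] at h1 h2
  have h3 : hb.equiv hb' (Tw R (w₀ I) • m I) = Tw R (w₀ I) • m' I := by
    rw [← h1, ← h2, equiv_apply]
  rw [Submodule.map_span, Set.image_singleton]
  exact congrArg (fun x => Submodule.span (ZeroHecke R n) {x}) h3

end IsDescentBasis

/-! ### Norton's left ideals -/

variable [IsDomain R]

/-- A nonzero left ideal of `H_n(0)` that is complemented and on which at most one character does not
vanish is indecomposable. The unit has orthogonal idempotent components in the two summands and in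
the complement; that character would take the value `1` on both idempotents of the summands. -/
theorem isIndecomposable_of_character {A : Finset (Fin (n - 1))}
    {N Q : Submodule (ZeroHecke R n) (ZeroHecke R n)} (hN : N ≠ ⊥) (hc : IsCompl N Q)
    (hA : ∀ B, B ≠ A → ∀ x ∈ N, character R B x = 0) : IsIndecomposable (ZeroHecke R n) N := by
  refine ⟨Submodule.nontrivial_iff_ne_bot.2 hN, fun U V hUV => ?_⟩
  obtain ⟨p, hp, q, hq, hpq⟩ := Submodule.mem_sup.1
    (hc.sup_eq_top ▸ Submodule.mem_top : (1 : ZeroHecke R n) ∈ N ⊔ Q)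
  obtain ⟨u, hu, v, hv, huv⟩ := Submodule.mem_sup.1
    (hUV.sup_eq_top ▸ Submodule.mem_top : (⟨p, hp⟩ : N) ∈ U ⊔ V)
  -- Right multiplication by `p` fixes `N`.
  have hNp : ∀ x ∈ N, x * p = x := by
    intro x hx
    have h1 : x * q ∈ N := by
      have : x * q = x - x * p := by rw [eq_sub_iff_add_eq', ← mul_add, hpq, mul_one]
      rw [this]
      exact sub_mem hx (N.smul_mem x hp)
    have h2 := (Submodule.disjoint_def.1 hc.disjoint) _ h1 (Q.smul_mem x hq)
    have h3 : x * p + x * q = x := by rw [← mul_add, hpq, mul_one]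
    rwa [h2, add_zero] at h3
  have hsplit : ∀ x : N, (x : ZeroHecke R n) • u + (x : ZeroHecke R n) • v = x := by
    intro x
    rw [← smul_add, huv]
    exact Subtype.ext (hNp x x.2)
  have hU : ∀ x ∈ U, (x : ZeroHecke R n) • u = x ∧ (x : ZeroHecke R n) • v = 0 := by
    intro x hx
    have h1 : (x : ZeroHecke R n) • v ∈ U := by
      have := hsplit x
      rw [← eq_sub_iff_add_eq'] at this
      rw [this]
      exact sub_mem hx (U.smul_mem _ hu)
    have h2 := (Submodule.disjoint_def.1 hUV.disjoint) _ h1 (V.smul_mem _ hv)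
    have h3 := hsplit x
    rw [h2, add_zero] at h3
    exact ⟨h3, h2⟩
  have hV : ∀ x ∈ V, (x : ZeroHecke R n) • v = x := by
    intro x hx
    have h1 : (x : ZeroHecke R n) • u ∈ V := by
      have := hsplit x
      rw [← eq_sub_iff_add_eq] at this
      rw [this]
      exact sub_mem hx (V.smul_mem _ hv)
    have h2 := (Submodule.disjoint_def.1 hUV.disjoint) _ (U.smul_mem _ hu) h1
    have h3 := hsplit x
    rwa [h2, zero_add] at h3
  have hchar : ∀ e : N, (e : ZeroHecke R n) * e = e → (e : ZeroHecke R n) ≠ 0 →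
      character R A e = 1 := by
    intro e he hne
    have h1 : character R A e ≠ 0 := by
      intro h
      refine hne (idempotent_eq_zero he fun B => ?_)
      by_cases hB : B = A
      · rwa [hB]
      · exact hA B hB _ e.2
    refine mul_left_cancel₀ h1 ?_
    rw [← map_mul, he, mul_one]
  have huu : (u : ZeroHecke R n) * u = u := congrArg Subtype.val (hU u hu).1
  have huv0 : (u : ZeroHecke R n) * v = 0 := congrArg Subtype.val (hU u hu).2
  have hvv : (v : ZeroHecke R n) * v = v := congrArg Subtype.val (hV v hv)
  by_cases hu0 : u = 0
  · left
    rw [eq_bot_iff]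
    intro x hx
    have := (hU x hx).1
    rw [hu0, smul_zero] at this
    exact this ▸ zero_mem _
  · by_cases hv0 : v = 0
    · right
      rw [eq_bot_iff]
      intro x hx
      have := hV x hx
      rw [hv0, smul_zero] at this
      exact this ▸ zero_mem _
    · have h1 := hchar u huu fun h => hu0 (Subtype.ext h)
      have h2 := hchar v hvv fun h => hv0 (Subtype.ext h)
      have h3 := congrArg (character R A) huv0
      rw [map_mul, h1, h2, map_zero, mul_one] at h3
      exact absurd h3 one_ne_zero

end Descent

/-! ### The order on exponents -/

section Exponents

variable {n : ℕ}

/-- The strictly decreasing weight `(n, n - 1, …, 1)`. -/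
def rho (i : Fin n) : ℕ := n - i

theorem rho_strictAnti : StrictAnti (rho : Fin n → ℕ) := by
  intro i j h
  have := j.isLt
  rw [Fin.lt_def] at h
  simp only [rho]
  omega

/-- The value of the weight `rho` on the exponent `a`, rearranged by `σ`. -/
def weight (σ : Perm (Fin n)) (a : Fin n → ℕ) : ℕ := ∑ i, a (σ i) * rho i

theorem weight_add (σ : Perm (Fin n)) (a b : Fin n → ℕ) :
    weight σ (a + b) = weight σ a + weight σ b := by
  simp [weight, add_mul, Finset.sum_add_distrib]

theorem weight_single (σ : Perm (Fin n)) (j : Fin n) (k : ℕ) :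
    weight σ (Pi.single j k) = k * rho (σ⁻¹ j) := by
  unfold weight
  rw [Finset.sum_eq_single (σ⁻¹ j)]
  · rw [← Perm.mul_apply, mul_inv_cancel, Perm.one_apply, Pi.single_eq_same]
  · intro b _ hb
    rw [Pi.single_eq_of_ne, zero_mul]
    rintro rfl
    exact hb (by rw [← Perm.mul_apply, inv_mul_cancel, Perm.one_apply])
  · simp

/-- The permutation that sorts an exponent in decreasing order, keeping the order of equal
entries. -/
def sortPerm (a : Fin n → ℕ) : Perm (Fin n) := Tuple.sort (OrderDual.toDual ∘ a)

theorem eq_sortPerm_iff {a : Fin n → ℕ} {w : Perm (Fin n)} :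
    w = sortPerm a ↔ Antitone (a ∘ w) ∧ ∀ i j, i < j → a (w i) = a (w j) → w i < w j := by
  rw [sortPerm, Tuple.eq_sort_iff]
  rfl

theorem antitone_sortPerm (a : Fin n → ℕ) : Antitone (a ∘ sortPerm a) :=
  (eq_sortPerm_iff.1 rfl).1

/-- The largest weight of a rearrangement of `a`. By the rearrangement inequality it is attained
when `a` is sorted in decreasing order. -/
def maxWeight (a : Fin n → ℕ) : ℕ := weight (sortPerm a) a

theorem weight_le_maxWeight (σ : Perm (Fin n)) (a : Fin n → ℕ) : weight σ a ≤ maxWeight a := by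
  have h := ((antitone_sortPerm a).monovary rho_strictAnti.antitone).sum_comp_perm_mul_le_sum_mul
    (σ := (sortPerm a)⁻¹ * σ)
  simpa [weight, maxWeight] using h

theorem weight_eq_maxWeight_iff {σ : Perm (Fin n)} {a : Fin n → ℕ} :
    weight σ a = maxWeight a ↔ Antitone (a ∘ σ) := by
  have h := ((antitone_sortPerm a).monovary
    rho_strictAnti.antitone).sum_comp_perm_mul_eq_sum_mul_iff (σ := (sortPerm a)⁻¹ * σ)
  have h1 : (a ∘ sortPerm a) ∘ ((sortPerm a)⁻¹ * σ : Perm (Fin n)) = a ∘ σ := by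
    ext i; simp
  rw [h1] at h
  have h2 : weight σ a = maxWeight a ↔ Monovary (a ∘ σ) rho := by
    rw [← h]
    simp [weight, maxWeight]
  rw [h2]
  refine ⟨fun hm i j hij => ?_, fun ha => ha.monovary rho_strictAnti.antitone⟩
  rcases hij.eq_or_lt with rfl | hij
  · exact le_rfl
  · exact hm (rho_strictAnti hij)

theorem maxWeight_comp (a : Fin n → ℕ) (σ : Perm (Fin n)) : maxWeight (a ∘ σ) = maxWeight a := by
  rw [← weight_eq_maxWeight_iff.2 (show Antitone (a ∘ (σ * sortPerm (a ∘ σ) : Perm (Fin n))) from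
    antitone_sortPerm (a ∘ σ))]
  rfl

theorem maxWeight_add_le (a b : Fin n → ℕ) : maxWeight (a + b) ≤ maxWeight a + maxWeight b := by
  conv_lhs => rw [maxWeight, weight_add]
  exact add_le_add (weight_le_maxWeight _ _) (weight_le_maxWeight _ _)

/-- The largest weight is additive on `a` and `b` exactly if these can be sorted
simultaneously. -/
theorem maxWeight_add_eq_iff {a b : Fin n → ℕ} : maxWeight (a + b) = maxWeight a + maxWeight b ↔
    ∃ σ : Perm (Fin n), Antitone (a ∘ σ) ∧ Antitone (b ∘ σ) := by
  constructor
  · intro h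
    have h1 := weight_le_maxWeight (sortPerm (a + b)) a
    have h2 := weight_le_maxWeight (sortPerm (a + b)) b
    rw [maxWeight, weight_add] at h
    exact ⟨sortPerm (a + b), weight_eq_maxWeight_iff.1 (by omega),
      weight_eq_maxWeight_iff.1 (by omega)⟩
  · rintro ⟨σ, ha, hb⟩
    rw [← weight_eq_maxWeight_iff.2 ha, ← weight_eq_maxWeight_iff.2 hb, ← weight_add, eq_comm,
      weight_eq_maxWeight_iff]
    exact ha.add hb

/-- Moving part of the larger of two entries to the smaller one lowers the largest weight. -/
theorem maxWeight_lt {c : Fin n → ℕ} {p q : Fin n} (hpq : p ≠ q) (hc : c p = c q) {k l : ℕ}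
    (hk : 0 < k) (hl : 0 < l) :
    maxWeight (c + Pi.single p k + Pi.single q l) < maxWeight (c + Pi.single p (k + l)) := by
  have hswap : c + Pi.single q (k + l) = (c + Pi.single p (k + l)) ∘ Equiv.swap p q := by
    ext x
    rcases eq_or_ne x p with rfl | hx
    · simp [hpq, hpq.symm, hc]
    rcases eq_or_ne x q with rfl | hx'
    · simp [hc]
    · simp [Equiv.swap_apply_of_ne_of_ne hx hx', hx, hx']
  -- For a rearrangement of the left side with largest weight, moving everything to whichever of the
  -- two positions carries the larger weight is a strict gain.
  set σ := sortPerm (c + Pi.single p k + Pi.single q l) with hσ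
  have h1 := weight_le_maxWeight σ (c + Pi.single p (k + l))
  have h2 := weight_le_maxWeight σ (c + Pi.single q (k + l))
  rw [hswap, maxWeight_comp, ← hswap] at h2
  rw [weight_add, weight_single] at h1 h2
  rw [maxWeight, ← hσ, weight_add, weight_add, weight_single, weight_single]
  have hne : rho (σ⁻¹ p) ≠ rho (σ⁻¹ q) := fun e =>
    hpq ((σ⁻¹).injective (rho_strictAnti.injective e))
  rw [add_mul] at h1 h2
  rcases lt_or_gt_of_ne hne with h | h
  · have := Nat.mul_lt_mul_of_pos_left h hk
    omega
  · have := Nat.mul_lt_mul_of_pos_left h hl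
    omega

/-- The pairs of positions at which the exponent increases. -/
def rises (a : Fin n → ℕ) : Finset (Fin n × Fin n) :=
  Finset.univ.filter fun p => p.1 < p.2 ∧ a p.1 < a p.2

theorem mem_rises {a : Fin n → ℕ} {p : Fin n × Fin n} :
    p ∈ rises a ↔ p.1 < p.2 ∧ a p.1 < a p.2 := by
  simp [rises]

/-- The rank of an exponent in the monomial order: exponents are compared by largest weight, and for
equal largest weight the one with fewer rises is the larger one. The factor `n * n + 1` exceeds
every number of rises. -/
def rank (a : Fin n → ℕ) : ℕ := (n * n + 1) * (maxWeight a + 1) - (rises a).card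

theorem card_rises_le (a : Fin n → ℕ) : (rises a).card ≤ n * n := by
  refine (Finset.card_le_univ _).trans ?_
  simp

theorem rank_lt_of_maxWeight_lt {a b : Fin n → ℕ} (h : maxWeight b < maxWeight a) :
    rank b < rank a := by
  have h1 := card_rises_le a
  have h2 : (n * n + 1) * (maxWeight b + 1) + (n * n + 1) ≤ (n * n + 1) * (maxWeight a + 1) := by
    rw [← Nat.mul_succ]
    exact Nat.mul_le_mul_left _ (by omega)
  unfold rank
  omega

theorem rank_lt_of_card_rises_lt {a b : Fin n → ℕ} (h : maxWeight b = maxWeight a)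
    (h' : (rises a).card < (rises b).card) : rank b < rank a := by
  have h1 := card_rises_le b
  have h2 : n * n + 1 ≤ (n * n + 1) * (maxWeight a + 1) := Nat.le_mul_of_pos_right _ (by omega)
  unfold rank
  rw [h]
  omega

/-! ### Descent exponents -/

/-- The exponent of the monomial `x_I`. -/
def descentExp (I : Finset (Fin (n - 1))) (k : Fin n) : ℕ := ∑ i ∈ I, if k ≤ lo i then 1 else 0

theorem descentExp_antitone (I : Finset (Fin (n - 1))) : Antitone (descentExp I) := by
  intro p q h
  refine Finset.sum_le_sum fun i _ => ?_
  split_ifs with h1 h2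
  · exact le_rfl
  · exact absurd (h.trans h1) h2
  · exact Nat.zero_le _
  · exact le_rfl

theorem descentExp_lo (I : Finset (Fin (n - 1))) (i : Fin (n - 1)) :
    descentExp I (lo i) = descentExp I (hi i) + if i ∈ I then 1 else 0 := by
  have h : ∀ j ∈ I, (if lo i ≤ lo j then 1 else 0 : ℕ) =
      (if hi i ≤ lo j then 1 else 0) + if i = j then 1 else 0 := by
    intro j _
    simp only [lo, hi, Fin.le_def, Fin.ext_iff]
    split_ifs <;> omega
  rw [descentExp, Finset.sum_congr rfl h, Finset.sum_add_distrib, Finset.sum_ite_eq, descentExp]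

/-- Two positions whose values under `u` are in reversed order enclose a descent. -/
theorem exists_descent {u : Perm (Fin n)} {p r : Fin n} (hpr : p < r) (hu : u r < u p) :
    ∃ i ∈ descentSet u, p ≤ lo i ∧ hi i ≤ r := by
  by_contra! hcon
  have key : ∀ k : ℕ, (p : ℕ) ≤ k → ∀ hk : k < n, k ≤ r → u p ≤ u ⟨k, hk⟩ := by
    intro k hpk
    induction k, hpk using Nat.le_induction with
    | base => intro _ _; exact le_rfl
    | succ k hpk ih =>
      intro hk hkr
      refine (ih (by omega) (by omega)).trans ?_
      let i : Fin (n - 1) := ⟨k, by omega⟩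
      have hi' : i ∉ descentSet u := fun h => by
        have h2 := hcon i h hpk
        rw [Fin.lt_def] at h2
        simp only [hi, i] at h2
        omega
      exact (lt_of_notMem_descentSet hi').le
  exact absurd hu (not_lt.2 (key r (Fin.lt_def.1 hpr).le r.isLt le_rfl))

theorem descentExp_lt {I : Finset (Fin (n - 1))} {u : Perm (Fin n)} (hI : descentSet u ⊆ I)
    {p r : Fin n} (hpr : p < r) (hu : u r < u p) : descentExp I r < descentExp I p := by
  obtain ⟨i, hi', h1, h2⟩ := exists_descent hpr hu
  have h3 := descentExp_antitone I h1
  have h4 := descentExp_antitone I h2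
  have h5 := descentExp_lo I i
  rw [if_pos (hI hi')] at h5
  omega

/-- Rearranging a partition whose differences contain all descents of `w` gives an exponent that
is sorted by `w`. -/
theorem sortPerm_comp_inv {w : Perm (Fin n)} {ν : Fin n → ℕ} (hν : Antitone ν) :
    sortPerm ((descentExp (descentSet w) + ν) ∘ (w⁻¹ : Perm (Fin n))) = w := by
  symm
  have h : ((descentExp (descentSet w) + ν) ∘ (w⁻¹ : Perm (Fin n))) ∘ w =
      descentExp (descentSet w) + ν := by ext i; simp
  rw [eq_sortPerm_iff]
  refine ⟨by rw [h]; exact (descentExp_antitone _).add hν, fun i j hij he => ?_⟩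
  have h1 := congrFun h i
  have h2 := congrFun h j
  simp only [Function.comp_apply, Pi.add_apply] at h1 h2 he
  rw [h1, h2] at he
  by_contra hlt
  have h3 : w j < w i := lt_of_le_of_ne (not_lt.1 hlt) fun e => hij.ne' (w.injective e)
  have h4 := descentExp_lt subset_rfl hij h3
  have h5 := hν hij.le
  omega

/-- The exponents of the leading monomials: the rearrangements by `w` of the partitions
`λ_{D(w)} + ν`. -/
def leadingExp (x : Perm (Fin n) × {ν : Fin n → ℕ // Antitone ν}) : Fin n → ℕ :=
  (descentExp (descentSet x.1) + x.2.1) ∘ (x.1⁻¹ : Perm (Fin n))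

theorem leadingExp_comp (w : Perm (Fin n)) (ν : {ν : Fin n → ℕ // Antitone ν}) :
    leadingExp (w, ν) ∘ w = descentExp (descentSet w) + ν.1 := by
  ext i; simp [leadingExp]

/-- Stable sorting recovers `w` from the exponent `w (λ_{D(w)} + ν)`. -/
theorem leadingExp_injective : Function.Injective (leadingExp (n := n)) := by
  rintro ⟨w, ν⟩ ⟨w', ν'⟩ h
  have h1 : w = w' := by
    rw [← sortPerm_comp_inv (w := w) ν.2, ← sortPerm_comp_inv (w := w') ν'.2]
    exact congrArg sortPerm h
  subst h1
  have h2 := leadingExp_comp w ν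
  rw [h, leadingExp_comp, add_right_inj] at h2
  rw [Subtype.ext h2]

theorem descentExp_last {m : ℕ} (I : Finset (Fin (m + 1 - 1))) : descentExp I (Fin.last m) = 0 := by
  refine Finset.sum_eq_zero fun i _ => if_neg ?_
  have := i.isLt
  simp only [lo, Fin.le_def, Fin.val_last]
  omega

/-- An exponent `a` with stable sorting permutation `w` is obtained from `w` and
`ν = a ∘ w - λ_{D(w)}`, since `a ∘ w` drops strictly at every descent of `w`. -/
theorem leadingExp_surjective : Function.Surjective (leadingExp (n := n)) := by
  intro a
  cases n with
  | zero => exact ⟨(1, ⟨0, fun _ _ _ => le_rfl⟩), Subsingleton.elim _ _⟩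
  | succ m =>
  obtain ⟨h1, h2⟩ := eq_sortPerm_iff.1 (rfl : sortPerm a = _)
  set w := sortPerm a with hw
  have hanti : Antitone fun k => (a (w k) : ℤ) - descentExp (descentSet w) k := by
    rw [Fin.antitone_iff_succ_le]
    intro i
    have h3 : descentExp (descentSet w) i.castSucc = descentExp (descentSet w) i.succ +
      if i ∈ descentSet w then 1 else 0 := descentExp_lo (n := m + 1) (descentSet w) i
    have h4 : a (w i.succ) ≤ a (w i.castSucc) := h1 i.castSucc_lt_succ.le
    rw [h3]
    split_ifs with hd
    · have h5 : a (w i.castSucc) ≠ a (w i.succ) := fun e =>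
        lt_asymm (h2 _ _ i.castSucc_lt_succ e) (mem_descentSet.1 hd)
      push_cast
      omega
    · push_cast
      omega
  have hle : ∀ k, descentExp (descentSet w) k ≤ a (w k) := by
    intro k
    have h3 := hanti (Fin.le_last k)
    simp only [descentExp_last] at h3
    omega
  refine ⟨(w, ⟨fun k => a (w k) - descentExp (descentSet w) k, fun p q hpq => ?_⟩), ?_⟩
  · have h3 := hanti hpq
    have h4 := hle p
    have h5 := hle q
    simp only at h3 ⊢
    omega
  · ext k
    have := hle (w⁻¹ k)
    simp only [leadingExp, Function.comp_apply, Pi.add_apply]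
    rw [add_tsub_cancel_of_le this, ← Perm.mul_apply, mul_inv_cancel, Perm.one_apply]

/-- The orbit of an exponent under permutation of the entries. -/
def orbit (ν : Fin n → ℕ) : Finset (Fin n → ℕ) :=
  Finset.univ.image fun σ : Perm (Fin n) => ν ∘ σ

theorem mem_orbit {ν c : Fin n → ℕ} : c ∈ orbit ν ↔ ∃ σ : Perm (Fin n), ν ∘ σ = c := by
  simp [orbit]

/-- Among all sums of the exponent `w λ_{D(w)}` and a rearrangement of the partition `ν`, the one
with `w ν` is the largest in the monomial order. -/
theorem rank_add_lt {w : Perm (Fin n)} {ν c : Fin n → ℕ} (hν : Antitone ν) (hc : c ∈ orbit ν)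
    (hne : c ≠ ν ∘ (w⁻¹ : Perm (Fin n))) :
    rank (descentExp (descentSet w) ∘ (w⁻¹ : Perm (Fin n)) + c) <
      rank ((descentExp (descentSet w) + ν) ∘ (w⁻¹ : Perm (Fin n))) := by
  obtain ⟨τ, hτ⟩ := mem_orbit.1 hc
  have hww : ∀ i, w⁻¹ (w i) = i := fun i => by
    rw [← Perm.mul_apply, inv_mul_cancel, Perm.one_apply]
  have hww' : ∀ i, w (w⁻¹ i) = i := fun i => by
    rw [← Perm.mul_apply, mul_inv_cancel, Perm.one_apply]
  have hcν : maxWeight c = maxWeight ν := by rw [← hτ, maxWeight_comp]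
  have hsum : maxWeight ((descentExp (descentSet w) + ν) ∘ (w⁻¹ : Perm (Fin n))) =
      maxWeight (descentExp (descentSet w) ∘ (w⁻¹ : Perm (Fin n))) + maxWeight c := by
    rw [hcν, maxWeight_comp, maxWeight_comp, maxWeight_add_eq_iff]
    exact ⟨1, descentExp_antitone _, hν⟩
  set lam := descentExp (descentSet w) with hlam
  rcases (maxWeight_add_le (lam ∘ (w⁻¹ : Perm (Fin n))) c).lt_or_eq with h | h
  · exact rank_lt_of_maxWeight_lt (hsum ▸ h)
  -- If the largest weights agree, then `w λ` and `c` can be sorted simultaneously, and the rises of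
  -- `w (λ + ν)`, which are rises of `w λ`, form a proper subset of those of `w λ + c`.
  refine rank_lt_of_card_rises_lt (h.trans hsum.symm) (Finset.card_lt_card ?_)
  obtain ⟨σ, hσ, hσ'⟩ := maxWeight_add_eq_iff.1 h
  -- A strict inequality between entries of `w λ` is weakly respected by `c`.
  have hord : ∀ i j, lam (w⁻¹ i) < lam (w⁻¹ j) → c i ≤ c j := by
    intro i j hij
    have hs : ∀ i, σ (σ⁻¹ i) = i := fun i => by
      rw [← Perm.mul_apply, mul_inv_cancel, Perm.one_apply]
    rcases le_total (σ⁻¹ j) (σ⁻¹ i) with h' | h'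
    · have := hσ' h'
      simpa only [Function.comp_apply, hs] using this
    · have := hσ h'
      simp only [Function.comp_apply, hs] at this
      omega
  have hanti : Antitone lam := descentExp_antitone _
  rw [Finset.ssubset_iff_of_subset]
  · -- If no rise is added, then `c` is sorted by `w`.
    by_contra! hcon
    refine hne ?_
    have hcw : Antitone (c ∘ w) := by
      intro p r hpr
      rcases hpr.eq_or_lt with rfl | hpr
      · exact le_rfl
      rcases (hanti hpr.le).lt_or_eq with h' | h'
      · exact hord _ _ (by rwa [hww, hww])
      · by_contra hlt
        rw [not_le] at hlt
        have hwpr : w p < w r := by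
          by_contra h''
          have := descentExp_lt (u := w) subset_rfl hpr
            (lt_of_le_of_ne (not_lt.1 h'') fun e => hpr.ne' (w.injective e))
          exact absurd h' this.ne
        have h1 : (w p, w r) ∈ rises (lam ∘ (w⁻¹ : Perm (Fin n)) + c) := by
          refine mem_rises.2 ⟨hwpr, ?_⟩
          simp only [Pi.add_apply, Function.comp_apply, hww, h']
          exact Nat.add_lt_add_left hlt _
        have h2 := (mem_rises.1 (hcon _ h1)).2
        simp only [Pi.add_apply, Function.comp_apply, hww] at h2
        exact absurd h2 (not_lt.2 (add_le_add h'.le (hν hpr.le)))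
    have h1 : ν ∘ (τ * w : Perm (Fin n)) = c ∘ w := by rw [← hτ]; rfl
    have h2 := Tuple.unique_antitone (f := ν) (σ := τ * w) (τ := 1) (h1 ▸ hcw) hν
    rw [h1] at h2
    ext i
    have := congrFun h2 (w⁻¹ i)
    simpa [hww'] using this
  · rintro ⟨i, j⟩ hij
    rw [mem_rises] at hij ⊢
    obtain ⟨hlt, hval⟩ := hij
    simp only [Pi.add_apply, Function.comp_apply] at hlt hval ⊢
    have hrise : lam (w⁻¹ i) < lam (w⁻¹ j) := by
      by_contra hge
      rw [not_lt] at hge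
      have : w⁻¹ i < w⁻¹ j := by
        by_contra hpr
        have hpr' : w⁻¹ j < w⁻¹ i :=
          lt_of_le_of_ne (not_lt.1 hpr) fun e => hlt.ne' ((w⁻¹).injective e)
        have := descentExp_lt (u := w) subset_rfl hpr' (by rwa [hww', hww'])
        exact absurd this (not_lt.2 hge)
      have := hν this.le
      omega
    exact ⟨hlt, Nat.add_lt_add_of_lt_of_le hrise (hord i j hrise)⟩

end Exponents

/-! ### Monomials and Demazure operators -/

section Monomials

variable {R : Type*} [CommRing R] {n : ℕ}

/-- The basis of monomials of the polynomial ring, indexed by functions. -/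
def monomialBasis (R : Type*) [CommRing R] (n : ℕ) :
    Module.Basis (Fin n → ℕ) R (MvPolynomial (Fin n) R) :=
  (MvPolynomial.basisMonomials (Fin n) R).reindex Finsupp.equivFunOnFinite

theorem monomialBasis_eq_prod (a : Fin n → ℕ) :
    monomialBasis R n a = ∏ j, MvPolynomial.X j ^ a j := by
  rw [monomialBasis, Module.Basis.reindex_apply, MvPolynomial.coe_basisMonomials]
  beta_reduce
  rw [MvPolynomial.monomial_eq, Finsupp.prod_fintype _ _ fun _ => pow_zero _]
  simp

theorem monomialBasis_zero : monomialBasis R n 0 = 1 := by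
  simp [monomialBasis_eq_prod]

theorem monomialBasis_add (a b : Fin n → ℕ) :
    monomialBasis R n (a + b) = monomialBasis R n a * monomialBasis R n b := by
  simp [monomialBasis_eq_prod, pow_add, Finset.prod_mul_distrib]

theorem monomialBasis_single (j : Fin n) (k : ℕ) :
    monomialBasis R n (Pi.single j k) = MvPolynomial.X j ^ k := by
  rw [monomialBasis_eq_prod, Finset.prod_eq_single j]
  · rw [Pi.single_eq_same]
  · intro b _ hb
    rw [Pi.single_eq_of_ne hb, pow_zero]
  · simp

theorem rename_monomialBasis (σ : Perm (Fin n)) (a : Fin n → ℕ) :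
    MvPolynomial.rename σ (monomialBasis R n a) =
      monomialBasis R n (a ∘ (σ⁻¹ : Perm (Fin n))) := by
  rw [monomialBasis_eq_prod, monomialBasis_eq_prod, map_prod]
  conv_rhs => rw [← Equiv.prod_comp σ]
  refine Finset.prod_congr rfl fun j _ => ?_
  simp

theorem constantCoeff_monomialBasis {a : Fin n → ℕ} (ha : a ≠ 0) :
    MvPolynomial.constantCoeff (monomialBasis R n a) = 0 := by
  obtain ⟨j, hj⟩ := Function.ne_iff.1 ha
  rw [monomialBasis_eq_prod, map_prod]
  refine Finset.prod_eq_zero (Finset.mem_univ j) ?_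
  rw [map_pow, MvPolynomial.constantCoeff_X, zero_pow hj]

theorem xSet_eq (I : Finset (Fin (n - 1))) : xSet R I = monomialBasis R n (descentExp I) := by
  rw [monomialBasis_eq_prod, xSet]
  have : ∀ i ∈ I, ∏ j ∈ Finset.Iic (lo i), (MvPolynomial.X j : MvPolynomial (Fin n) R) =
      ∏ j, MvPolynomial.X j ^ (if j ≤ lo i then 1 else 0) := by
    intro i _
    rw [← Finset.prod_subset (Finset.subset_univ (Finset.Iic (lo i)))]
    · refine Finset.prod_congr rfl fun j hj => ?_
      rw [if_pos (Finset.mem_Iic.1 hj), pow_one]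
    · intro j _ hj
      rw [if_neg (mt Finset.mem_Iic.2 hj), pow_zero]
  rw [Finset.prod_congr rfl this, Finset.prod_comm]
  refine Finset.prod_congr rfl fun j _ => ?_
  rw [Finset.prod_pow_eq_pow_sum, descentExp]

/-- The span of the monomials whose exponents have largest weight smaller than `t`. -/
def lower (R : Type*) [CommRing R] (n t : ℕ) : Submodule R (MvPolynomial (Fin n) R) :=
  Submodule.span R (monomialBasis R n '' {b | maxWeight b < t})

theorem monomialBasis_mem_lower {a : Fin n → ℕ} {t : ℕ} (h : maxWeight a < t) :
    monomialBasis R n a ∈ lower R n t := Submodule.subset_span ⟨a, h, rfl⟩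

theorem lower_mono {t t' : ℕ} (h : t ≤ t') : lower R n t ≤ lower R n t' :=
  Submodule.span_mono (Set.image_mono fun _ (hb : _ < t) => lt_of_lt_of_le hb h)

/-- Every exponent arises from one with equal entries at `i` and `i + 1` by enlarging one of these
entries. -/
theorem exponent_cases (i : Fin (n - 1)) (a : Fin n → ℕ) :
    ∃ (c : Fin n → ℕ) (d : ℕ), c (lo i) = c (hi i) ∧
      (a = c + Pi.single (lo i) d ∨ a = c + Pi.single (hi i) (d + 1)) := by
  rcases le_or_gt (a (hi i)) (a (lo i)) with h | h
  · refine ⟨Function.update a (lo i) (a (hi i)), a (lo i) - a (hi i), ?_, Or.inl ?_⟩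
    · simp [(lo_ne_hi i).symm]
    · ext x
      rcases eq_or_ne x (lo i) with rfl | hx
      · simp [h]
      · simp [hx]
  · refine ⟨Function.update a (hi i) (a (lo i)), a (hi i) - a (lo i) - 1, ?_, Or.inr ?_⟩
    · simp [lo_ne_hi i]
    · ext x
      rcases eq_or_ne x (hi i) with rfl | hx
      · simp; omega
      · simp [hx]

theorem comp_s_of_eq {i : Fin (n - 1)} {c : Fin n → ℕ} (hc : c (lo i) = c (hi i)) :
    c ∘ s i = c := by
  ext x
  rcases eq_or_ne x (lo i) with rfl | hx
  · simp [s_lo, hc]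
  rcases eq_or_ne x (hi i) with rfl | hx'
  · simp [s_hi, hc]
  · simp [s, Equiv.swap_apply_of_ne_of_ne hx hx']

theorem act_monomialBasis_of_eq {i : Fin (n - 1)} {c : Fin n → ℕ} (hc : c (lo i) = c (hi i)) :
    act i (monomialBasis R n c) = monomialBasis R n c := by
  rw [act, rename_monomialBasis, s_inv, comp_s_of_eq hc]

theorem single_comp_s_lo (i : Fin (n - 1)) (d : ℕ) :
    (Pi.single (lo i) d : Fin n → ℕ) ∘ s i = Pi.single (hi i) d := by
  ext x
  have hx : s i x = lo i ↔ x = hi i := by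
    rw [← s_hi, (s i).injective.eq_iff]
  simp only [Function.comp_apply, Pi.single_apply, hx]

theorem add_single_comp_s {i : Fin (n - 1)} {c : Fin n → ℕ} (hc : c (lo i) = c (hi i)) (d : ℕ) :
    (c + Pi.single (lo i) d) ∘ s i = c + Pi.single (hi i) d := by
  rw [← single_comp_s_lo]
  conv_rhs => rw [← comp_s_of_eq hc]
  rfl

theorem maxWeight_single_hi {i : Fin (n - 1)} {c : Fin n → ℕ} (hc : c (lo i) = c (hi i)) (d : ℕ) :
    maxWeight (c + Pi.single (hi i) d) = maxWeight (c + Pi.single (lo i) d) := by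
  rw [← add_single_comp_s hc, maxWeight_comp]

variable [IsDomain R]

theorem demazureBar_mul_of_act_eq (i : Fin (n - 1)) (f g : MvPolynomial (Fin n) R)
    (hf : act i f = f) : demazureBar R i (f * g) = f * demazureBar R i g := by
  have := demazure_mul_of_act_eq i f g hf
  simp only [demazureBar, LinearMap.sub_apply, Module.End.one_apply, this, mul_sub]

theorem demazure_X_lo_pow (i : Fin (n - 1)) (d : ℕ) :
    demazure i (MvPolynomial.X (lo i) ^ d : MvPolynomial (Fin n) R) =
      ∑ j ∈ Finset.range (d + 1), MvPolynomial.X (lo i) ^ j * MvPolynomial.X (hi i) ^ (d - j) := by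
  refine eq_demazureFun i ?_
  have h := (Commute.all (MvPolynomial.X (lo i) : MvPolynomial (Fin n) R)
    (MvPolynomial.X (hi i))).mul_geom_sum₂ (d + 1)
  simp only [Nat.add_sub_cancel] at h
  rw [h, map_pow, act_X, s_lo, ← pow_succ', ← pow_succ']

theorem demazure_X_hi_pow (i : Fin (n - 1)) (d : ℕ) :
    demazure i (MvPolynomial.X (hi i) ^ (d + 1) : MvPolynomial (Fin n) R) =
      -∑ j ∈ Finset.range d, MvPolynomial.X (lo i) ^ (j + 1) * MvPolynomial.X (hi i) ^ (d - j) := by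
  refine eq_demazureFun i ?_
  have h := (Commute.all (MvPolynomial.X (lo i) : MvPolynomial (Fin n) R)
    (MvPolynomial.X (hi i))).mul_geom_sum₂ d
  have h' : ∑ j ∈ Finset.range d, (MvPolynomial.X (lo i) : MvPolynomial (Fin n) R) ^ (j + 1) *
      MvPolynomial.X (hi i) ^ (d - j) = MvPolynomial.X (lo i) * MvPolynomial.X (hi i) *
      ∑ j ∈ Finset.range d, MvPolynomial.X (lo i) ^ j * MvPolynomial.X (hi i) ^ (d - 1 - j) := by
    rw [Finset.mul_sum]
    refine Finset.sum_congr rfl fun j hj => ?_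
    have : d - j = (d - 1 - j) + 1 := by have := Finset.mem_range.1 hj; omega
    rw [this]
    ring
  rw [h', map_pow, act_X, s_hi]
  linear_combination (-(MvPolynomial.X (lo i) * MvPolynomial.X (hi i)) : MvPolynomial (Fin n) R) * h

theorem demazureBar_monomialBasis_of_eq {i : Fin (n - 1)} {c : Fin n → ℕ}
    (hc : c (lo i) = c (hi i)) : demazureBar R i (monomialBasis R n c) = 0 := by
  have h1 : demazure i (1 : MvPolynomial (Fin n) R) = 1 := by simpa using demazure_X_lo_pow i 0
  rw [← mul_one (monomialBasis R n c), demazureBar_mul_of_act_eq i _ _ (act_monomialBasis_of_eq hc)]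
  simp [demazureBar, h1]

theorem demazureBar_monomialBasis_lo {i : Fin (n - 1)} {c : Fin n → ℕ} (hc : c (lo i) = c (hi i))
    (d : ℕ) : demazureBar R i (monomialBasis R n (c + Pi.single (lo i) (d + 1))) -
      monomialBasis R n (c + Pi.single (hi i) (d + 1)) ∈
        lower R n (maxWeight (c + Pi.single (lo i) (d + 1))) := by
  have h : demazureBar R i (monomialBasis R n (c + Pi.single (lo i) (d + 1))) -
      monomialBasis R n (c + Pi.single (hi i) (d + 1)) = ∑ j ∈ Finset.range d,
        monomialBasis R n (c + Pi.single (lo i) (j + 1) + Pi.single (hi i) (d - j)) := by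
    simp only [monomialBasis_add, mul_assoc]
    rw [demazureBar_mul_of_act_eq i _ _ (act_monomialBasis_of_eq hc), ← mul_sub, ← Finset.mul_sum]
    congr 1
    simp only [monomialBasis_single, demazureBar, LinearMap.sub_apply, Module.End.one_apply,
      demazure_X_lo_pow]
    rw [Finset.sum_range_succ, Finset.sum_range_succ']
    simp
  rw [h]
  refine sum_mem fun j hj => monomialBasis_mem_lower ?_
  have hj' := Finset.mem_range.1 hj
  have := maxWeight_lt (lo_ne_hi i) hc (k := j + 1) (l := d - j) (by omega) (by omega)
  rwa [show j + 1 + (d - j) = d + 1 by omega] at this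

theorem demazureBar_monomialBasis_hi {i : Fin (n - 1)} {c : Fin n → ℕ} (hc : c (lo i) = c (hi i))
    (d : ℕ) : demazureBar R i (monomialBasis R n (c + Pi.single (hi i) (d + 1))) +
      monomialBasis R n (c + Pi.single (hi i) (d + 1)) ∈
        lower R n (maxWeight (c + Pi.single (hi i) (d + 1))) := by
  have h : demazureBar R i (monomialBasis R n (c + Pi.single (hi i) (d + 1))) +
      monomialBasis R n (c + Pi.single (hi i) (d + 1)) = -∑ j ∈ Finset.range d,
        monomialBasis R n (c + Pi.single (lo i) (j + 1) + Pi.single (hi i) (d - j)) := by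
    simp only [monomialBasis_add, mul_assoc]
    rw [demazureBar_mul_of_act_eq i _ _ (act_monomialBasis_of_eq hc), ← mul_add, ← Finset.mul_sum,
      ← mul_neg]
    congr 1
    simp only [monomialBasis_single, demazureBar, LinearMap.sub_apply, Module.End.one_apply,
      demazure_X_hi_pow]
    abel
  rw [h]
  refine neg_mem (sum_mem fun j hj => monomialBasis_mem_lower ?_)
  have hj' := Finset.mem_range.1 hj
  have := maxWeight_lt (lo_ne_hi i) hc (k := j + 1) (l := d - j) (by omega) (by omega)
  rw [maxWeight_single_hi hc]
  rwa [show j + 1 + (d - j) = d + 1 by omega] at this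

/-- If the entry at `i` exceeds the entry at `i + 1`, then `π̄_i` exchanges the two entries, modulo
lower monomials. -/
theorem demazureBar_monomialBasis_of_lt {i : Fin (n - 1)} {a : Fin n → ℕ}
    (h : a (hi i) < a (lo i)) :
    demazureBar R i (monomialBasis R n a) - monomialBasis R n (a ∘ s i) ∈
      lower R n (maxWeight a) := by
  obtain ⟨c, d, hc, rfl | rfl⟩ := exponent_cases i a
  · have hd : d ≠ 0 := by
      rintro rfl
      simp [hc] at h
    obtain ⟨e, rfl⟩ := Nat.exists_eq_succ_of_ne_zero hd
    rw [add_single_comp_s hc]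
    exact demazureBar_monomialBasis_lo hc e
  · simp [hc, lo_ne_hi i] at h

theorem demazureBar_mem_lower (i : Fin (n - 1)) {t : ℕ} {f : MvPolynomial (Fin n) R}
    (hf : f ∈ lower R n t) : demazureBar R i f ∈ lower R n t := by
  unfold lower at hf
  induction hf using Submodule.span_induction with
  | mem y hy =>
    obtain ⟨a, ha, rfl⟩ := hy
    have ha' : maxWeight a < t := ha
    obtain ⟨c, d, hc, rfl | rfl⟩ := exponent_cases i a
    · rcases d with _ | d
      · rw [Pi.single_zero, add_zero, demazureBar_monomialBasis_of_eq hc]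
        exact zero_mem _
      · have h1 := lower_mono ha'.le (demazureBar_monomialBasis_lo (R := R) hc d)
        have h2 : monomialBasis R n (c + Pi.single (hi i) (d + 1)) ∈ lower R n t :=
          monomialBasis_mem_lower (by rwa [maxWeight_single_hi hc])
        simpa using add_mem h1 h2
    · have h1 := lower_mono ha'.le (demazureBar_monomialBasis_hi (R := R) hc d)
      simpa using sub_mem h1 (monomialBasis_mem_lower ha')
  | zero => rw [map_zero]; exact zero_mem _
  | add y z _ _ hy hz => rw [map_add]; exact add_mem hy hz
  | smul r y _ hy => rw [map_smul]; exact Submodule.smul_mem _ _ hy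

theorem isBraided_demazureBar : IsBraided (demazureBar R (n := n)) where
  braid := demazureBar_braid
  comm := demazureBar_comm

/-- The leading term of the Demazure atom `π̄_w x_I` is the monomial `w x_I`, provided that `I`
contains the descents of `w`. -/
theorem demazureBarW_sub_mem {I : Finset (Fin (n - 1))} (w : Perm (Fin n))
    (hw : descentSet w ⊆ I) :
    demazureBarW R w (xSet R I) - monomialBasis R n (descentExp I ∘ (w⁻¹ : Perm (Fin n))) ∈
      lower R n (maxWeight (descentExp I)) := by
  induction w using perm_induction with
  | h1 =>
    have : demazureBarW R (1 : Perm (Fin n)) = 1 := wordProd_one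
    rw [this, xSet_eq]
    simp
  | hs i u hu ih =>
    have ih' := ih ((descentSet_subset_s_mul hu).trans hw)
    have h1 : demazureBarW R (s i * u) = demazureBar R i * demazureBarW R u :=
      (isBraided_demazureBar.mul_wordProd hu).symm
    set a := descentExp I ∘ (u⁻¹ : Perm (Fin n)) with ha
    -- The positions that `u` sends to `i` and `i + 1` are inverted by `s_i u`, so they enclose a
    -- descent of `s_i u`, which lies in `I`.
    have hlt : a (hi i) < a (lo i) := by
      refine descentExp_lt hw (lt_of_notMem_descentSet hu) ?_
      rw [Perm.mul_apply, Perm.mul_apply, ← Perm.mul_apply u, mul_inv_cancel, Perm.one_apply,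
        ← Perm.mul_apply u, mul_inv_cancel, Perm.one_apply, s_lo, s_hi]
      exact lo_lt_hi i
    have h2 := demazureBar_monomialBasis_of_lt (R := R) hlt
    have h3 : descentExp I ∘ ((s i * u)⁻¹ : Perm (Fin n)) = a ∘ s i := by
      rw [mul_inv_rev, s_inv, ha]
      rfl
    have h4 : maxWeight a = maxWeight (descentExp I) := maxWeight_comp _ _
    rw [h4] at h2
    have h5 := add_mem (demazureBar_mem_lower i ih') h2
    rw [h1, h3, Module.End.mul_apply]
    convert h5 using 1
    rw [map_sub]
    abel

end Monomials

/-! ### Monomial symmetric polynomials and the coinvariant algebra -/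

section Coinvariants

variable {R : Type*} [CommRing R] {n : ℕ}

/-- The monomial symmetric polynomial attached to an exponent. -/
def orbitSum (R : Type*) [CommRing R] {n : ℕ} (ν : Fin n → ℕ) : MvPolynomial (Fin n) R :=
  ∑ c ∈ orbit ν, monomialBasis R n c

theorem comp_mem_orbit {ν c : Fin n → ℕ} (hc : c ∈ orbit ν) (σ : Perm (Fin n)) :
    c ∘ σ ∈ orbit ν := by
  obtain ⟨τ, rfl⟩ := mem_orbit.1 hc
  exact mem_orbit.2 ⟨τ * σ, rfl⟩

theorem orbitSum_isSymmetric (ν : Fin n → ℕ) : (orbitSum R ν).IsSymmetric := by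
  intro σ
  rw [orbitSum, map_sum]
  simp only [rename_monomialBasis]
  refine Finset.sum_nbij' (fun c => c ∘ (σ⁻¹ : Perm (Fin n))) (fun c => c ∘ σ)
    (fun c hc => comp_mem_orbit hc _) (fun c hc => comp_mem_orbit hc _) ?_ ?_ fun c _ => rfl
  · intro c _; ext x; simp
  · intro c _; ext x; simp

theorem orbitSum_zero : orbitSum R (0 : Fin n → ℕ) = 1 := by
  have : orbit (0 : Fin n → ℕ) = {0} := by
    ext c
    rw [mem_orbit, Finset.mem_singleton]
    exact ⟨fun ⟨_, h⟩ => h.symm, fun h => ⟨1, h.symm⟩⟩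
  rw [orbitSum, this, Finset.sum_singleton, monomialBasis_zero]

theorem constantCoeff_orbitSum {ν : Fin n → ℕ} (hν : ν ≠ 0) :
    MvPolynomial.constantCoeff (orbitSum R ν) = 0 := by
  rw [orbitSum, map_sum]
  refine Finset.sum_eq_zero fun c hc => constantCoeff_monomialBasis ?_
  rintro rfl
  obtain ⟨σ, hσ⟩ := mem_orbit.1 hc
  refine hν (funext fun i => ?_)
  have := congrFun hσ (σ⁻¹ i)
  simpa using this

/-- A symmetric polynomial without constant term is a combination of monomial symmetric polynomials
attached to nonzero partitions. -/
theorem mem_span_orbitSum {g : MvPolynomial (Fin n) R} (hg : g.IsSymmetric)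
    (h0 : MvPolynomial.constantCoeff g = 0) :
    g ∈ Submodule.span R (orbitSum R '' {ν | Antitone ν ∧ ν ≠ 0}) := by
  classical
  set B := monomialBasis R n with hB
  have hsym : ∀ (σ : Perm (Fin n)) (a : Fin n → ℕ), B.repr g (a ∘ σ) = B.repr g a := by
    intro σ a
    have hlin : (B.coord a) ∘ₗ (MvPolynomial.rename (R := R) σ).toLinearMap = B.coord (a ∘ σ) := by
      refine B.ext fun c => ?_
      simp only [LinearMap.comp_apply, AlgHom.toLinearMap_apply, hB, rename_monomialBasis,
        Module.Basis.coord_apply, Module.Basis.repr_self, Finsupp.single_apply]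
      have : c ∘ (σ⁻¹ : Perm (Fin n)) = a ↔ c = a ∘ σ := by
        constructor
        · rintro rfl; ext x; simp
        · rintro rfl; ext x; simp
      simp only [this]
    have := LinearMap.congr_fun hlin g
    simp only [LinearMap.comp_apply, AlgHom.toLinearMap_apply, Module.Basis.coord_apply] at this
    rw [← this, hg σ]
  have hzero : B.repr g 0 = 0 := by
    have hlin : B.coord 0 = (MvPolynomial.lcoeff R (0 : Fin n →₀ ℕ)) := by
      refine B.ext fun c => ?_
      rw [Module.Basis.coord_apply, Module.Basis.repr_self, MvPolynomial.lcoeff_apply,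
        ← MvPolynomial.constantCoeff_eq, Finsupp.single_apply]
      split_ifs with hc
      · rw [hc, hB, monomialBasis_zero, map_one]
      · rw [hB, constantCoeff_monomialBasis hc]
    have := LinearMap.congr_fun hlin g
    rwa [Module.Basis.coord_apply, MvPolynomial.lcoeff_apply, ← MvPolynomial.constantCoeff_eq,
      h0] at this
  let st : (Fin n → ℕ) → (Fin n → ℕ) := fun a => a ∘ sortPerm a
  have hst : ∀ {a ν}, Antitone ν → (st a = ν ↔ a ∈ orbit ν) := by
    intro a ν hν
    rw [mem_orbit]
    constructor
    · rintro rfl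
      exact ⟨(sortPerm a)⁻¹, by ext x; simp [st]⟩
    · rintro ⟨σ, rfl⟩
      exact Tuple.unique_antitone (f := ν) (σ := σ * sortPerm (ν ∘ σ)) (τ := 1)
        (antitone_sortPerm (ν ∘ σ)) hν
  have hsum : g = ∑ a ∈ (B.repr g).support, B.repr g a • B a := by
    conv_lhs => rw [← B.linearCombination_repr g]
    rfl
  rw [hsum, ← Finset.sum_fiberwise_of_maps_to (g := st) (t := (B.repr g).support.image st)
    fun a ha => Finset.mem_image_of_mem _ ha]
  refine sum_mem fun ν hν => ?_
  obtain ⟨a, ha, rfl⟩ := Finset.mem_image.1 hν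
  have hanti : Antitone (st a) := antitone_sortPerm a
  have hrepr : B.repr g (st a) = B.repr g a := hsym _ _
  have hfib : (B.repr g).support.filter (fun c => st c = st a) = orbit (st a) := by
    ext c
    rw [Finset.mem_filter, hst hanti, and_iff_right_iff_imp]
    intro hc
    obtain ⟨σ, rfl⟩ := mem_orbit.1 hc
    rw [Finsupp.mem_support_iff, hsym, hrepr]
    exact Finsupp.mem_support_iff.1 ha
  have hcoef : ∀ c ∈ orbit (st a), B.repr g c • B c = B.repr g (st a) • B c := by
    intro c hc
    obtain ⟨σ, rfl⟩ := mem_orbit.1 hc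
    rw [hsym]
  rw [hfib, Finset.sum_congr rfl hcoef, ← Finset.smul_sum]
  refine Submodule.smul_mem _ _ (Submodule.subset_span ⟨st a, ⟨hanti, fun h => ?_⟩, rfl⟩)
  rw [h, hzero] at hrepr
  exact Finsupp.mem_support_iff.1 ha hrepr.symm

variable [IsDomain R]

/-- The products of Demazure atoms with monomial symmetric polynomials. -/
def atomMul (R : Type*) [CommRing R] [IsDomain R] {n : ℕ}
    (x : Perm (Fin n) × {ν : Fin n → ℕ // Antitone ν}) : MvPolynomial (Fin n) R :=
  demazureBarW R x.1 (xSet R (descentSet x.1)) * orbitSum R x.2.1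

/-- The leading monomial of `π̄_w x_{D(w)} m_ν` has the exponent `w (λ_{D(w)} + ν)`. -/
theorem atomMul_sub_mem (x : Perm (Fin n) × {ν : Fin n → ℕ // Antitone ν}) :
    atomMul R x - monomialBasis R n (leadingExp x) ∈
      Submodule.span R (monomialBasis R n '' {b | rank b < rank (leadingExp x)}) := by
  obtain ⟨w, ν, hν⟩ := x
  set D := descentSet w with hD
  have hmax : maxWeight (leadingExp (w, ⟨ν, hν⟩)) = maxWeight (descentExp D) + maxWeight ν := by
    rw [leadingExp, maxWeight_comp, maxWeight_add_eq_iff]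
    exact ⟨1, descentExp_antitone _, hν⟩
  set N := Submodule.span R (monomialBasis R n '' {b | rank b < rank (leadingExp (w, ⟨ν, hν⟩))})
  have h1 : ∀ r ∈ lower R n (maxWeight (descentExp D)), ∀ c ∈ orbit ν,
      r * monomialBasis R n c ∈ N := by
    intro r hr c hc
    unfold lower at hr
    induction hr using Submodule.span_induction with
    | mem y hy =>
      obtain ⟨b, hb, rfl⟩ := hy
      rw [← monomialBasis_add]
      refine Submodule.subset_span ⟨_, rank_lt_of_maxWeight_lt ?_, rfl⟩
      have hb' : maxWeight b < maxWeight (descentExp D) := hb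
      obtain ⟨σ, rfl⟩ := mem_orbit.1 hc
      have h2 := maxWeight_add_le b (ν ∘ σ)
      rw [maxWeight_comp] at h2
      rw [hmax]
      omega
    | zero => rw [zero_mul]; exact zero_mem _
    | add y z _ _ hy hz => rw [add_mul]; exact add_mem hy hz
    | smul r y _ hy => rw [smul_mul_assoc]; exact Submodule.smul_mem _ _ hy
  have h2 : ν ∘ (w⁻¹ : Perm (Fin n)) ∈ orbit ν := mem_orbit.2 ⟨w⁻¹, rfl⟩
  have h3 : leadingExp (w, ⟨ν, hν⟩) =
      descentExp D ∘ (w⁻¹ : Perm (Fin n)) + ν ∘ (w⁻¹ : Perm (Fin n)) := rfl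
  have h4 := demazureBarW_sub_mem (R := R) w subset_rfl
  set r := demazureBarW R w (xSet R D) -
    monomialBasis R n (descentExp D ∘ (w⁻¹ : Perm (Fin n))) with hr
  have h5 : atomMul R (w, ⟨ν, hν⟩) - monomialBasis R n (leadingExp (w, ⟨ν, hν⟩)) =
      ∑ c ∈ orbit ν, r * monomialBasis R n c +
        ∑ c ∈ (orbit ν).erase (ν ∘ (w⁻¹ : Perm (Fin n))),
          monomialBasis R n (descentExp D ∘ (w⁻¹ : Perm (Fin n)) + c) := by
    have h6 := Finset.add_sum_erase (orbit ν)
      (fun c => monomialBasis R n (descentExp D ∘ (w⁻¹ : Perm (Fin n)) + c)) h2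
    rw [← h3] at h6
    rw [← eq_sub_iff_add_eq'] at h6
    rw [h6, ← Finset.mul_sum]
    simp only [monomialBasis_add]
    rw [← Finset.mul_sum, hr, atomMul, ← orbitSum]
    ring
  rw [h5]
  refine add_mem (sum_mem fun c hc => h1 r h4 c hc) (sum_mem fun c hc => ?_)
  rw [Finset.mem_erase] at hc
  exact Submodule.subset_span ⟨_, rank_add_lt hν hc.2 hc.1, rfl⟩

/-- The polynomial ring has the basis of products of Demazure atoms and monomial symmetric
polynomials; in particular the Demazure atoms are a basis over the symmetric polynomials. -/
def atomMulBasis (R : Type*) [CommRing R] [IsDomain R] (n : ℕ) :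
    Module.Basis (Perm (Fin n) × {ν : Fin n → ℕ // Antitone ν}) R (MvPolynomial (Fin n) R) :=
  Module.Basis.mk
    (linearIndependent_of_triangular (monomialBasis R n) rank leadingExp_injective
      (atomMul_sub_mem (R := R)))
    (span_eq_top_of_triangular (monomialBasis R n) rank leadingExp_surjective
      (atomMul_sub_mem (R := R))).ge

theorem atomMulBasis_apply (x : Perm (Fin n) × {ν : Fin n → ℕ // Antitone ν}) :
    atomMulBasis R n x = atomMul R x := Module.Basis.mk_apply _ _ _

/-- The ideal defining the coinvariant algebra is spanned by the basis elements that involve a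
nonconstant monomial symmetric polynomial. -/
theorem mem_coinvIdeal_iff (f : MvPolynomial (Fin n) R) :
    f ∈ coinvIdeal R n ↔ f ∈ Submodule.span R (atomMulBasis R n '' {x | x.2.1 ≠ 0}) := by
  set N := Submodule.span R (atomMulBasis R n '' {x | x.2.1 ≠ 0}) with hN
  constructor
  · intro hf
    have key : ∀ p : MvPolynomial (Fin n) R, p * f ∈ N := by
      unfold coinvIdeal at hf
      induction hf using Submodule.span_induction with
      | mem g hg =>
        intro p
        have hp : p ∈ Submodule.span R (Set.range (atomMulBasis R n)) :=
          (atomMulBasis R n).mem_span p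
        induction hp using Submodule.span_induction with
        | mem q hq =>
          obtain ⟨⟨w, ν⟩, rfl⟩ := hq
          rw [atomMulBasis_apply, atomMul, mul_assoc]
          have hsym : (orbitSum R ν.1 * g).IsSymmetric := (orbitSum_isSymmetric ν.1).mul hg.1
          have hspan := mem_span_orbitSum hsym (by rw [map_mul, hg.2, mul_zero])
          generalize orbitSum R ν.1 * g = y at hspan ⊢
          induction hspan using Submodule.span_induction with
          | mem y hy =>
            obtain ⟨μ, hμ, rfl⟩ := hy
            refine Submodule.subset_span ⟨(w, ⟨μ, hμ.1⟩), hμ.2, ?_⟩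
            rw [atomMulBasis_apply, atomMul]
          | zero => rw [mul_zero]; exact zero_mem _
          | add y z _ _ hy hz => rw [mul_add]; exact add_mem hy hz
          | smul r y _ hy => rw [mul_smul_comm]; exact Submodule.smul_mem _ _ hy
        | zero => rw [zero_mul]; exact zero_mem _
        | add y z _ _ hy hz => rw [add_mul]; exact add_mem hy hz
        | smul r y _ hy => rw [smul_mul_assoc]; exact Submodule.smul_mem _ _ hy
      | zero => intro p; rw [mul_zero]; exact zero_mem _
      | add x y _ _ hx hy => intro p; rw [mul_add]; exact add_mem (hx p) (hy p)
      | smul a x _ hx => intro p; rw [smul_eq_mul, ← mul_assoc]; exact hx _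
    simpa using key 1
  · intro hf
    have hle : N ≤ (coinvIdeal R n).restrictScalars R := by
      rw [hN, Submodule.span_le]
      rintro _ ⟨x, hx, rfl⟩
      rw [atomMulBasis_apply]
      exact Ideal.mul_mem_left _ _
        (Ideal.subset_span ⟨orbitSum_isSymmetric _, constantCoeff_orbitSum hx⟩)
    exact hle hf

theorem toCoinv_atomMul_zero (w : Perm (Fin n)) :
    toCoinv R n (atomMul R (w, ⟨0, fun _ _ _ => le_rfl⟩)) = atom R w (descentSet w) := by
  rw [atomMul, orbitSum_zero, mul_one, atom]

theorem linearIndependent_atom :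
    LinearIndependent R fun w : Perm (Fin n) => atom R w (descentSet w) := by
  rw [Fintype.linearIndependent_iff]
  intro g hg w
  let z : Perm (Fin n) → Perm (Fin n) × {ν : Fin n → ℕ // Antitone ν} :=
    fun w => (w, ⟨0, fun _ _ _ => le_rfl⟩)
  have h1 : ∑ w, g w • atomMulBasis R n (z w) ∈ coinvIdeal R n := by
    rw [← toCoinv_eq_zero_iff, map_sum, ← hg]
    refine Finset.sum_congr rfl fun w _ => ?_
    rw [map_smul, atomMulBasis_apply, toCoinv_atomMul_zero]
  rw [mem_coinvIdeal_iff, Module.Basis.mem_span_image] at h1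
  by_contra hgw
  have h2 : (atomMulBasis R n).repr (∑ w, g w • atomMulBasis R n (z w)) (z w) = g w := by
    simp only [map_sum, map_smul, Module.Basis.repr_self, Finsupp.coe_finsetSum, Finset.sum_apply,
      Finsupp.smul_apply, Finsupp.single_apply, smul_eq_mul]
    rw [Finset.sum_eq_single w]
    · simp
    · intro v _ hv
      rw [if_neg fun e => hv (congrArg Prod.fst e), mul_zero]
    · simp
  have h3 : z w ∈ ((atomMulBasis R n).repr (∑ w, g w • atomMulBasis R n (z w))).support := by
    rw [Finsupp.mem_support_iff, h2]
    exact hgw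
  exact h1 h3 rfl

theorem span_atom :
    Submodule.span R (Set.range fun w : Perm (Fin n) => atom R w (descentSet w)) = ⊤ := by
  rw [eq_top_iff]
  intro x _
  obtain ⟨f, rfl⟩ := toCoinv_surjective x
  have hf : f ∈ Submodule.span R (Set.range (atomMulBasis R n)) := (atomMulBasis R n).mem_span f
  induction hf using Submodule.span_induction with
  | mem y hy =>
    obtain ⟨⟨w, ν, hν⟩, rfl⟩ := hy
    by_cases h : ν = 0
    · subst h
      rw [atomMulBasis_apply, toCoinv_atomMul_zero]
      exact Submodule.subset_span ⟨w, rfl⟩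
    · have h1 : atomMulBasis R n (w, ⟨ν, hν⟩) ∈ coinvIdeal R n :=
        (mem_coinvIdeal_iff _).2 (Submodule.subset_span ⟨_, h, rfl⟩)
      rw [(toCoinv_eq_zero_iff _).2 h1]
      exact zero_mem _
  | zero => rw [map_zero]; exact zero_mem _
  | add y z _ _ hy hz => rw [map_add]; exact add_mem (hy trivial) (hz trivial)
  | smul r y _ hy => rw [map_smul]; exact Submodule.smul_mem _ _ (hy trivial)

/-- The basis of Demazure atoms of the coinvariant algebra. -/
def atomBasis (R : Type*) [CommRing R] [IsDomain R] (n : ℕ) :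
    Module.Basis (Perm (Fin n)) R (CoinvAlg R n) :=
  Module.Basis.mk linearIndependent_atom span_atom.ge

theorem atomBasis_apply (w : Perm (Fin n)) : atomBasis R n w = atom R w (descentSet w) :=
  Module.Basis.mk_apply _ _ _

theorem Tw_smul_toCoinv (w : Perm (Fin n)) (f : MvPolynomial (Fin n) R) :
    Tw R w • toCoinv R n f = toCoinv R n (demazureBarW R w f) := by
  have key : ∀ l : List (Fin (n - 1)), (l.map (T R)).prod • toCoinv R n f =
      toCoinv R n ((l.map (demazureBar R)).prod f) := by
    intro l
    induction l with
    | nil => simp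
    | cons i l ih =>
      rw [List.map_cons, List.prod_cons, mul_smul, ih, T_smul, List.map_cons, List.prod_cons]
      rfl
  exact key _

theorem Tw_smul_xSet (w : Perm (Fin n)) (I : Finset (Fin (n - 1))) :
    Tw R w • toCoinv R n (xSet R I) = atom R w I := Tw_smul_toCoinv w _

/-- The coinvariant algebra has a descent basis: `π̄_i` annihilates `x_I` for `i ∉ I`, as `x_I` is
then symmetric in `x_i` and `x_{i+1}`. -/
theorem isDescentBasis_atomBasis :
    IsDescentBasis (fun I => toCoinv R n (xSet R I)) (atomBasis R n) where
  T_smul_eq_zero I i hi' := by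
    have h : descentExp I (lo i) = descentExp I (hi i) := by
      rw [descentExp_lo, if_neg hi', add_zero]
    have h1 := demazureBar_monomialBasis_of_eq (R := R) h
    rw [T_smul, xSet_eq]
    exact (congrArg _ h1).trans (map_zero _)
  apply_eq w := by rw [Tw_smul_xSet, atomBasis_apply]

/-! ### The regular representation -/

/-- The representation `T_i ↦ π̄_i` of `H_n(0)` on the polynomial ring. -/
def polynomialRep (R : Type*) [CommRing R] [IsDomain R] (n : ℕ) :
    ZeroHecke R n →ₐ[R] Module.End R (MvPolynomial (Fin n) R) :=
  RingQuot.liftAlgHom R ⟨FreeAlgebra.lift R (demazureBar R), by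
    intro x y h
    induction h with
    | quad i => simp only [map_mul, map_neg, FreeAlgebra.lift_ι_apply, demazureBar_quad]
    | braid i j hij =>
      simp only [map_mul, FreeAlgebra.lift_ι_apply, demazureBar_braid i j hij]
    | comm i j hij => simp only [map_mul, FreeAlgebra.lift_ι_apply, demazureBar_comm i j hij]⟩

theorem polynomialRep_Tw (w : Perm (Fin n)) :
    polynomialRep R n (Tw R w) = demazureBarW R w := by
  have h : ∀ i : Fin (n - 1), polynomialRep R n (T R i) = demazureBar R i := fun i => by
    unfold polynomialRep T
    exact (RingQuot.liftAlgHom_mkAlgHom_apply R _ _ _).trans (FreeAlgebra.lift_ι_apply _ _)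
  rw [Tw, map_list_prod, List.map_map, demazureBarW]
  congr 2
  exact funext h

/-- The elements `T_w` are linearly independent: applied to the monomial `x_{[n-1]}`, whose exponent
is strictly decreasing, they have different leading monomials. -/
theorem linearIndependent_Tw : LinearIndependent R (Tw R : Perm (Fin n) → ZeroHecke R n) := by
  refine LinearIndependent.of_comp
    ((LinearMap.applyₗ (xSet R (Finset.univ : Finset (Fin (n - 1))))) ∘ₗ
      (polynomialRep R n).toLinearMap) ?_
  refine linearIndependent_of_triangular (monomialBasis R n) maxWeight
    (L := fun w : Perm (Fin n) => descentExp Finset.univ ∘ (w⁻¹ : Perm (Fin n))) ?_ fun w => ?_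
  · have hinj : Function.Injective (descentExp (Finset.univ : Finset (Fin (n - 1)))) := by
      have hlt : ∀ p r : Fin n, p < r → descentExp (Finset.univ : Finset (Fin (n - 1))) r <
          descentExp (Finset.univ : Finset (Fin (n - 1))) p := fun p r hpr =>
        -- The reversal permutation inverts every pair of positions.
        descentExp_lt (u := Fin.revPerm) (Finset.subset_univ _) hpr (by simpa using hpr)
      intro p r h
      rcases lt_trichotomy p r with h' | h' | h'
      · exact absurd h (hlt _ _ h').ne'
      · exact h'
      · exact absurd h (hlt _ _ h').ne
    intro w v h
    have : w⁻¹ = v⁻¹ := Equiv.ext fun x => hinj (congrFun h x)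
    exact inv_injective this
  · rw [maxWeight_comp]
    have := demazureBarW_sub_mem (R := R) w (Finset.subset_univ _)
    rw [← polynomialRep_Tw] at this
    exact this

/-- The basis `T_w` of `H_n(0)`. -/
def TwBasis (R : Type*) [CommRing R] [IsDomain R] (n : ℕ) :
    Module.Basis (Perm (Fin n)) R (ZeroHecke R n) :=
  Module.Basis.mk linearIndependent_Tw span_Tw.ge

theorem TwBasis_apply (w : Perm (Fin n)) : TwBasis R n w = Tw R w := Module.Basis.mk_apply _ _ _

/-- The products `T_w T'_{w₀(D(w)ᶜ)}` are unitriangular with respect to the basis `T_w`, when longer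
permutations rank lower. -/
theorem Tw_mul_Tw'_triangular : ∃ key : Perm (Fin n) → ℕ, ∀ w : Perm (Fin n),
    Tw R w * Tw' R (w₀ (descentSet w)ᶜ) - TwBasis R n (id w) ∈
      Submodule.span R (TwBasis R n '' {v | key v < key (id w)}) := by
  obtain ⟨u, hu⟩ := Finite.exists_max (len : Perm (Fin n) → ℕ)
  refine ⟨fun v => len u - len v, fun w => ?_⟩
  have h1 : (TwBasis R n : Perm (Fin n) → ZeroHecke R n) = Tw R := funext TwBasis_apply
  rw [h1]
  refine Submodule.span_mono (Set.image_mono fun v hv => ?_) (Tw_mul_Tw'_sub_mem w)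
  have hv' : len w < len v := hv
  have := hu v
  change len u - len v < len u - len w
  omega

/-- The basis `T_w T'_{w₀(D(w)ᶜ)}` of `H_n(0)`. -/
def nortonBasis (R : Type*) [CommRing R] [IsDomain R] (n : ℕ) :
    Module.Basis (Perm (Fin n)) R (ZeroHecke R n) :=
  Module.Basis.mk
    (linearIndependent_of_triangular (TwBasis R n) (Tw_mul_Tw'_triangular (R := R)).choose
      Function.injective_id (Tw_mul_Tw'_triangular (R := R)).choose_spec)
    (span_eq_top_of_triangular (TwBasis R n) (Tw_mul_Tw'_triangular (R := R)).choose
      Function.surjective_id (Tw_mul_Tw'_triangular (R := R)).choose_spec).ge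

theorem isDescentBasis_nortonBasis :
    IsDescentBasis (fun I => Tw' R (w₀ Iᶜ)) (nortonBasis R n) where
  T_smul_eq_zero I i hi' := by
    rw [smul_eq_mul, T_mul_Tw']
    rw [descentSet_w₀_inv]
    exact Finset.mem_compl.2 hi'
  apply_eq w := Module.Basis.mk_apply _ _ _

/-- Compositions of `n` correspond to subsets of `[n - 1]`. -/
theorem compDescentSet_bijective : Function.Bijective (compDescentSet (n := n)) := by
  have h : (compDescentSet : Composition n → Finset (Fin (n - 1))) =
      (compositionAsSetEquiv n) ∘ (compositionEquiv n) := by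
    ext α i
    simp only [compDescentSet, compositionAsSetEquiv, compositionEquiv, Function.comp_apply,
      Equiv.coe_fn_mk, Composition.toCompositionAsSet_boundaries, Finset.mem_filter,
      Finset.mem_univ, true_and, Finset.mem_image, Finset.mem_Ioo]
    refine Iff.trans ?_ Set.mem_toFinset.symm
    change _ ↔ _ ∈ α.boundaries
    have hi' := i.isLt
    rw [Composition.boundaries, Finset.mem_map]
    constructor
    · rintro ⟨j, ⟨h1, h2⟩, h3⟩
      refine ⟨⟨j, by omega⟩, Finset.mem_univ _, Fin.ext ?_⟩
      change α.sizeUpTo j = 1 + i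
      omega
    · rintro ⟨j, -, hj⟩
      have h3 : α.sizeUpTo j = 1 + i := congrArg Fin.val hj
      have h1 : (j : ℕ) ≠ 0 := by
        intro h
        rw [h, Composition.sizeUpTo_zero] at h3
        omega
      have h2 : (j : ℕ) ≠ α.length := by
        intro h
        rw [h, Composition.sizeUpTo_length] at h3
        omega
      have := j.isLt
      exact ⟨j, ⟨by omega, by omega⟩, by omega⟩
  rw [h]
  exact (compositionAsSetEquiv n).bijective.comp (compositionEquiv n).bijective

theorem summand_eq (α : Composition n) : summand R α = Submodule.span (ZeroHecke R n)
    {Tw R (w₀ (compDescentSet α)) • toCoinv R n (xSet R (compDescentSet α))} := by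
  rw [Tw_smul_xSet, summand]

theorem exists_isCompl_P (α : Composition n) :
    ∃ Q : Submodule (ZeroHecke R n) (ZeroHecke R n), IsCompl (P R α) Q := by
  have h := isDescentBasis_nortonBasis.isInternal (R := R) (compDescentSet_bijective (n := n))
  have h' := (DirectSum.isInternal_submodule_iff_iSupIndep_and_iSup_eq_top _).1 h
  refine ⟨_, h'.1 α, codisjoint_iff.2 ?_⟩
  rw [eq_top_iff, ← h'.2]
  refine iSup_le fun β => ?_
  by_cases hβ : β = α
  · subst hβ
    exact le_sup_left
  · exact le_sup_of_le_right (le_iSup₂_of_le β hβ le_rfl)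

theorem projective_P (α : Composition n) : Module.Projective (ZeroHecke R n) (P R α) := by
  obtain ⟨Q, hQ⟩ := exists_isCompl_P (R := R) α
  exact Module.Projective.of_split (P R α).subtype ((P R α).projectionOnto Q hQ)
    (Submodule.projectionOnto_comp_subtype hQ)

theorem P_ne_bot (α : Composition n) : P R α ≠ ⊥ := by
  intro h
  have h1 : nortonBasis R n (w₀ (compDescentSet α)) ∈ P R α := by
    rw [isDescentBasis_nortonBasis.apply_eq, descentSet_w₀]
    exact Submodule.mem_span_singleton_self _
  rw [h, Submodule.mem_bot] at h1
  exact (nortonBasis R n).ne_zero _ h1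

theorem isIndecomposable_P (α : Composition n) : IsIndecomposable (ZeroHecke R n) (P R α) := by
  obtain ⟨Q, hQ⟩ := exists_isCompl_P (R := R) α
  refine isIndecomposable_of_character (A := compDescentSet α) (P_ne_bot α) hQ fun B hB x hx => ?_
  obtain ⟨h, rfl⟩ := Submodule.mem_span_singleton.1 hx
  rw [smul_eq_mul, map_mul, character_generator_eq_zero hB, mul_zero]

end Coinvariants

end Coinv

end

theorem mainTheorem1 (R : Type*) [CommRing R] [IsDomain R] (n : ℕ) :
    (∃ b : Module.Basis (Perm (Fin n)) R (Coinv.CoinvAlg R n),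
      ∀ w, b w = Coinv.atom R w (Coinv.descentSet w)) ∧
    DirectSum.IsInternal (fun α : Composition n => Coinv.summand R α) ∧
    (∀ α : Composition n,
      (∃ b : Module.Basis {w : Perm (Fin n) // Coinv.descentSet w = Coinv.compDescentSet α} R
          (Coinv.summand R α),
        ∀ w, (b w : Coinv.CoinvAlg R n) = Coinv.atom R w.1 (Coinv.compDescentSet α)) ∧
      Nonempty (Coinv.summand R α ≃ₗ[Coinv.ZeroHecke R n] Coinv.P R α) ∧
      Module.Projective (Coinv.ZeroHecke R n) (Coinv.P R α) ∧
      Coinv.IsIndecomposable (Coinv.ZeroHecke R n) (Coinv.P R α)) ∧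
    Nonempty (Coinv.CoinvAlg R n ≃ₗ[Coinv.ZeroHecke R n] Coinv.ZeroHecke R n) := by
  have hC := Coinv.isDescentBasis_atomBasis (R := R) (n := n)
  have hH := Coinv.isDescentBasis_nortonBasis (R := R) (n := n)
  refine ⟨⟨Coinv.atomBasis R n, Coinv.atomBasis_apply⟩, ?_, fun α => ⟨?_, ?_,
    Coinv.projective_P α, Coinv.isIndecomposable_P α⟩, ⟨hC.equiv hH⟩⟩
  · have h := hC.isInternal (Coinv.compDescentSet_bijective (n := n))
    simp only [← Coinv.summand_eq] at h
    exact h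
  · obtain ⟨B, hB⟩ := hC.exists_basis (Coinv.compDescentSet α)
    rw [Coinv.summand_eq]
    exact ⟨B, fun w => (hB w).trans (Coinv.Tw_smul_xSet _ _)⟩
  · have h := hC.nonempty_equiv_span hH (Coinv.compDescentSet α)
    rw [← Coinv.summand_eq] at h
    exact h
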